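/- Let $d\ge 0$ and $m\ge 2$ be integers. Consider finite words over the alphabet $\{0,\dots,m-1\}$, read in a fixed direction (from the lowest digit on), as the vertices of the rooted $m$-ary tree $T_m$. Let $L_{-1,m}=\mathrm{Sym}(m)$ act on $T_m$ by permuting the first letter read. For $k\ge 0$, a word $w$ of length $k$ in the letters $\{1,\dots,m-1\}$, and an element $\sigma$ of $\mathrm{Sym}(m)\wr\mathrm{Sym}(m-1)$ (the automorphisms of the first two levels of $T_m$ that fix $0$ and its children), let $\lambda_{w,\sigma}\in\mathrm{Aut}(T_m)$ be the automorphism that acts on a word as follows: if the first $k$ nonzero letters of the word agree with $w$, then the $(k+1)$st nonzero letter and the letter immediately following it are permuted by $\sigma$; otherwise nothing is changed. Let $L_{k,m}$ be the subgroup of $\mathrm{Aut}(T_m)$ generated by all $\lambda_{w,\sigma}$ with $|w|=k$. The fractal mother graph $\mathcal G(d,m,n)$ is the Schreier graph on the set $\{0,\dots,m-1\}^n$ of words of length $n$ with respect to the generating set $\bigcup_{-1\le k\le d}L_{k,m}$, counted with multiplicity; thus the number of edges between $x$ and $y$ is the number of pairs $(k,g)$ with $-1\le k\le d$, $g\in L_{k,m}$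 and $g$ mapping $x$ to $y$. Let every edge have unit resistance, and let $\bar r(d,m,n)$ be the maximum over all pairs of vertices $x,y$ of the effective resistance between $x$ and $y$ in $\mathcal G(d,m,n)$. **Theorem.** Let $d\ge 0$ and $m\ge 2$. There is a constant $c>0$ depending only on $d$ and $m$ such that - if $d=0$, then $\bar r(0,m,n)\le c\left(\frac{m}{m-1}\right)^n$ for all $n\ge 1$; - if $d\in\{1,2\}$, then $\bar r(d,m,n)\le c\,n^{3-d-\log_m(m-1)}$ for all $n\ge 1$; - if $d=3$ and $m=2$, then $\bar r(3,2,n)\le c\log^2 n$ for all $n\ge 2$; - if $d\ge 4$, or if $d\ge 3$ and $m\ge 3$, then $\bar r(d,m,n)\le c$ for all $n\ge 1$. Moreover, for $d=0$ there is a constant $c'>0$ depending only on $m$ such that $\bar r(0,m,n)\ge c'\left(\frac{m}{m-1}\right)^n$ for all $n\ge 1$. -/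

import Mathlib

open scoped ENNReal

namespace FractalMother

/-! Words over the alphabet `{0, …, m-1}` are lists whose head is the letter that is read first
(written words in the literature have this letter on the right). The vertices of the `m`-ary rooted
tree are all finite words. -/

/-- Apply a permutation of the alphabet to the first letter of a word. -/
def headMap {m : ℕ} (σ : Equiv.Perm (Fin m)) : List (Fin m) → List (Fin m)
  | [] => []
  | x :: u => σ x :: u

/-- The element `σ ∈ Sym(m)` acting on the tree by permuting the first letter. -/
def headPerm {m : ℕ} (σ : Equiv.Perm (Fin m)) : Equiv.Perm (List (Fin m)) where
  toFun := headMap σ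
  invFun := headMap σ⁻¹
  left_inv u := by cases u <;> simp [headMap]
  right_inv u := by cases u <;> simp [headMap]

/-- An automorphism of the first two levels of the `m`-ary tree that fixes `0` and its children,
i.e. an element of `Sym(m) ≀ Sym(m-1)`: a nonzero letter `x` goes to `top x`, and a letter that
directly follows the nonzero letter `x` is permuted by `below x`. (The value `below 0` is never
used.) -/
structure TwoLevel (m : ℕ) where
  top : Equiv.Perm (Fin m)
  below : Fin m → Equiv.Perm (Fin m)
  top_zero : ∀ x : Fin m, x.val = 0 → top x = x

namespace TwoLevel

variable {m : ℕ}

theorem top_symm_zero (s : TwoLevel m) (x : Fin m) (hx : x.val = 0) : s.top.symm x = x := by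
  rw [Equiv.symm_apply_eq]
  exact (s.top_zero x hx).symm

theorem top_ne_zero (s : TwoLevel m) (x : Fin m) (hx : x.val ≠ 0) : (s.top x).val ≠ 0 := by
  intro h
  have h1 : s.top (s.top x) = s.top x := s.top_zero _ h
  have h2 : s.top x = x := s.top.injective h1
  rw [h2] at h
  exact hx h

/-- The inverse automorphism of the first two levels. -/
def inv (s : TwoLevel m) : TwoLevel m where
  top := s.top.symm
  below x := (s.below (s.top.symm x))⁻¹
  top_zero := s.top_symm_zero

end TwoLevel

/-- `lamMap s w u`: if the first `|w|` nonzero letters of `u` agree with `w`, then `s` is applied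
to the next nonzero letter of `u` and the letter that follows it; otherwise `u` is unchanged. -/
def lamMap {m : ℕ} (s : TwoLevel m) : List (Fin m) → List (Fin m) → List (Fin m)
  | _, [] => []
  | [], x :: u =>
      if x.val = 0 then x :: lamMap s [] u else s.top x :: headMap (s.below x) u
  | a :: w, x :: u =>
      if x.val = 0 then x :: lamMap s (a :: w) u
      else if x = a then x :: lamMap s w u
      else x :: u

theorem lamMap_inv_lamMap {m : ℕ} (s : TwoLevel m) (w u : List (Fin m)) :
    lamMap s.inv w (lamMap s w u) = u := by
  induction u generalizing w with
  | nil => simp [lamMap]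
  | cons x u ih =>
    cases w with
    | nil =>
      by_cases hx : x.val = 0
      · simp [lamMap, hx, ih]
      · have h := s.top_ne_zero x hx
        cases u <;> simp [lamMap, hx, h, TwoLevel.inv, headMap]
    | cons a w =>
      by_cases hx : x.val = 0
      · simp [lamMap, hx, ih]
      · by_cases ha : x = a
        · subst ha
          simp [lamMap, hx, ih]
        · simp [lamMap, hx, ha]

theorem lamMap_lamMap_inv {m : ℕ} (s : TwoLevel m) (w u : List (Fin m)) :
    lamMap s w (lamMap s.inv w u) = u := by
  induction u generalizing w with
  | nil => simp [lamMap]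
  | cons x u ih =>
    cases w with
    | nil =>
      by_cases hx : x.val = 0
      · simp [lamMap, hx, ih]
      · have h : (s.top.symm x).val ≠ 0 := s.inv.top_ne_zero x hx
        cases u <;> simp [lamMap, hx, h, TwoLevel.inv, headMap]
    | cons a w =>
      by_cases hx : x.val = 0
      · simp [lamMap, hx, ih]
      · by_cases ha : x = a
        · subst ha
          simp [lamMap, hx, ih]
        · simp [lamMap, hx, ha]

/-- The tree automorphism `λ_{w,s}`. -/
def lam {m : ℕ} (w : List (Fin m)) (s : TwoLevel m) : Equiv.Perm (List (Fin m)) where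
  toFun := lamMap s w
  invFun := lamMap s.inv w
  left_inv := lamMap_inv_lamMap s w
  right_inv := lamMap_lamMap_inv s w

/-- The level subgroups, with the index shifted by one: `levelGroup m 0` is `L_{-1,m} = Sym(m)`
acting on the first letter, and `levelGroup m (k+1)` is `L_{k,m}`, the group generated by all
`λ_{w,s}` with `w` a word of length `k` in the letters `1, …, m-1` and `s ∈ Sym(m) ≀ Sym(m-1)`. -/
def levelGroup (m : ℕ) : ℕ → Subgroup (Equiv.Perm (List (Fin m)))
  | 0 => Subgroup.closure {g | ∃ σ : Equiv.Perm (Fin m), g = headPerm σ}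
  | k + 1 => Subgroup.closure {g | ∃ (w : List (Fin m)) (s : TwoLevel m),
      w.length = k ∧ (∀ a ∈ w, a.val ≠ 0) ∧ g = lam w s}

/-- The fractal mother graph `G(d,m,n)`, given by its edge multiplicities: the Schreier graph of
the action on words of length `n`, with respect to the generating set `⋃_{-1 ≤ k ≤ d} L_{k,m}`
counted with multiplicity. The number of edges between `x` and `y` is the number of pairs `(k, g)`
with `-1 ≤ k ≤ d`, `g ∈ L_{k,m}` and `g x = y`. -/
noncomputable def motherGraph (d m n : ℕ) (x y : List.Vector (Fin m) n) : ℕ :=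
  ∑ j ∈ Finset.range (d + 2), Nat.card {g : levelGroup m j // g.1 x.1 = y.1}

/-- `v` is the voltage of a unit current from `a` to `b`, in the electrical network on the finite
multigraph with edge multiplicities `G` all of whose edges have unit resistance: the net current
out of `x` is `1` at `a`, `-1` at `b` and `0` elsewhere (the net current is `0` everywhere
if `a = b`). -/
def IsUnitVoltage {V : Type*} [Fintype V] [DecidableEq V] (G : V → V → ℕ) (a b : V)
    (v : V → ℝ) : Prop :=
  ∀ x, ∑ y, (G x y : ℝ) * (v x - v y) = (if x = a then 1 else 0) - (if x = b then 1 else 0)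

/-- The effective resistance between `a` and `b`: the voltage difference between `a` and `b` when
a unit current flows from `a` to `b`. It is `∞` if no such current exists (that is, if `a` and `b`
are not connected); otherwise all unit voltages give the same difference. -/
noncomputable def effResistance {V : Type*} [Fintype V] [DecidableEq V] (G : V → V → ℕ)
    (a b : V) : ℝ≥0∞ :=
  ⨅ (v : V → ℝ) (_ : IsUnitVoltage G a b v), ENNReal.ofReal (v a - v b)

/-- The maximal effective resistance between two vertices of `G(d,m,n)`. -/
noncomputable def maxResistance (d m n : ℕ) : ℝ≥0∞ :=
  ⨆ (x : List.Vector (Fin m) n) (y : List.Vector (Fin m) n),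
    effResistance (motherGraph d m n) x y

end FractalMother

namespace FractalMother

/-! ### Sums over words -/

/-! Upper bounds are proved in dual form. `ResBound` asks that a function on words of length n vary
by at most ρ times the root of its energy, where the energy counts only the explicit edges `Move`;
resistances are then at most 2ρ².

Two facts about the energy do all the work. The sections f(·w) for different suffixes w use disjoint
edges, so their energies add up to at most that of f (`sum_energy_append_le`). The sections f(0ⁱa·),
a ≠ 0, also use disjoint edges, and edges of a given level there come from edges one level higher
(`sum_energy_zerosCons_le`). Hence averaging N estimates with disjoint energies gains a factor 1/√N
(`abs_expect_le_div_sqrt`), the dual of splitting a current into N parallel ones.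

Degree 0: the oscillation between 0ⁿ⁺¹ and the average of 0ⁿa satisfies r ↦ √(m/(m-1))·r + 1, which
gives the exponential bound.

Degree 1: a point is compared with `spread`, the average over words 0ᴹa v with v of length about log
n. Advancing M by one costs a degree-0 resistance on words of length about log n, plus a corner term
that is averaged over many suffixes and so is small enough to be absorbed by bootstrapping. The
energies of the M steps are disjoint, so the ρ of degree 1 is √n times the ρ of degree 0 at length
about log n (`resBound_three`).

Higher degree: a point is compared with `layer`, the average over words 0ⁱa0ʲ with i in a window of
size h, and h is doubled repeatedly. The window offers about h disjoint prefixes, behind which the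
degree is one lower, so a doubling costs ρ/√h additively and a factor 1 + O(h^(-1/2))
multiplicatively. The factors have a convergent product. Summing over dyadic scales turns a bound
n^α for ρ into n^(α-1/2), log n or a constant according as α is above, equal to or below 1/2
(`resBound_succ`).

Lower bound: in degree 0 the explicit potential `pot` is constant along all edges of L₀, changes by
1 between two corner words, and has energy of order ((m-1)/m)ⁿ; Cauchy–Schwarz (`le_effResistance`)
concludes. -/

theorem sum_vector_cons {α : Type*} [Fintype α] (n : ℕ) (F : List α → ℝ) :
    ∑ x : List.Vector α (n + 1), F x.1 = ∑ a, ∑ u : List.Vector α n, F (a :: u.1) := by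
  rw [← Fintype.sum_prod_type']
  refine Finset.sum_bij' (fun x _ => (x.head, x.tail)) (fun p _ => p.1 ::ᵥ p.2) ?_ ?_ ?_ ?_ ?_
  · simp
  · simp
  · intro x _; simp
  · rintro ⟨a, u⟩ _; simp
  · intro x _
    conv_lhs => rw [← List.Vector.cons_head_tail x]
    rfl

theorem sum_vector_zero {α : Type*} [Fintype α] (F : List α → ℝ) :
    ∑ x : List.Vector α 0, F x.1 = F [] := by
  exact (Fintype.sum_subsingleton (fun x : List.Vector α 0 => F x.1) List.Vector.nil)

theorem sum_vector_append {α : Type*} [Fintype α] (n s : ℕ) (F : List α → ℝ) :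
    ∑ x : List.Vector α (n + s), F x.1
      = ∑ w : List.Vector α s, ∑ u : List.Vector α n, F (u.1 ++ w.1) := by
  induction n generalizing F with
  | zero =>
    rw [Nat.zero_add]
    refine Finset.sum_congr rfl fun w _ => ?_
    rw [sum_vector_zero (fun u => F (u ++ w.1))]; simp
  | succ n ih =>
    have h : ∀ N, N = n + s + 1 → ∑ x : List.Vector α N, F x.1
        = ∑ a, ∑ u : List.Vector α (n + s), F (a :: u.1) := by
      rintro N rfl
      exact sum_vector_cons _ F
    rw [h _ (by omega)]
    simp_rw [fun a => ih (fun u => F (a :: u))]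
    rw [Finset.sum_comm]
    refine Finset.sum_congr rfl fun w _ => ?_
    rw [sum_vector_cons n (fun u => F (u ++ w.1))]
    rfl

theorem sum_vector_one {α : Type*} [Fintype α] (F : List α → ℝ) :
    ∑ x : List.Vector α 1, F x.1 = ∑ a, F [a] := by
  rw [sum_vector_cons]
  exact Finset.sum_congr rfl fun a _ => sum_vector_zero (fun u => F (a :: u))

/-! ### Averages -/

open scoped BigOperators

theorem sqrt_mul_add_sqrt_mul_le {a b x y : ℝ} (ha : 0 ≤ a) (hb : 0 ≤ b) (hx : 0 ≤ x)
    (hy : 0 ≤ y) : √a * √x + √b * √y ≤ √(a + b) * √(x + y) := by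
  rw [← Real.sqrt_mul (add_nonneg ha hb)]
  apply Real.le_sqrt_of_sq_le
  have h1 := Real.sq_sqrt ha
  have h2 := Real.sq_sqrt hb
  have h3 := Real.sq_sqrt hx
  have h4 := Real.sq_sqrt hy
  calc (√a * √x + √b * √y) ^ 2 ≤ (√a ^ 2 + √b ^ 2) * (√x ^ 2 + √y ^ 2) := by
        nlinarith [sq_nonneg (√a * √y - √b * √x)]
    _ = _ := by rw [h1, h2, h3, h4]

/-- Cauchy–Schwarz: when the local energies `e i` share a common budget `E`, the average beats each
single estimate by the root of the number of terms. This is the source of every gain below. -/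
theorem abs_expect_le_div_sqrt {ι : Type*} [Fintype ι] [Nonempty ι] {g e : ι → ℝ} {K E : ℝ}
    (hK : 0 ≤ K) (he : ∀ i, 0 ≤ e i) (h : ∀ i, |g i| ≤ K * √(e i)) (hE : ∑ i, e i ≤ E) :
    |Finset.univ.expect g| ≤ K / √(Fintype.card ι) * √E := by
  have hc : (0 : ℝ) < Fintype.card ι := by exact_mod_cast Fintype.card_pos
  rw [Fintype.expect_eq_sum_div_card, abs_div, Nat.abs_cast, div_le_iff₀ hc]
  have h1 : ∑ i, √(e i) ≤ √(Fintype.card ι) * √E := by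
    rw [← Real.sqrt_mul hc.le]
    apply Real.le_sqrt_of_sq_le
    calc (∑ i, √(e i)) ^ 2 ≤ (Fintype.card ι : ℝ) * ∑ i, √(e i) ^ 2 := by
          have := sq_sum_le_card_mul_sum_sq (s := Finset.univ) (f := fun i => √(e i))
          simpa using this
      _ = (Fintype.card ι : ℝ) * ∑ i, e i := by simp_rw [fun i => Real.sq_sqrt (he i)]
      _ ≤ _ := by gcongr
  calc |∑ i, g i| ≤ ∑ i, |g i| := Finset.abs_sum_le_sum_abs _ _
    _ ≤ ∑ i, K * √(e i) := Finset.sum_le_sum fun i _ => h i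
    _ = K * ∑ i, √(e i) := by rw [Finset.mul_sum]
    _ ≤ K * (√(Fintype.card ι) * √E) := by gcongr
    _ = K / √(Fintype.card ι) * √E * Fintype.card ι := by
        have h2 : √(Fintype.card ι : ℝ) ≠ 0 := (Real.sqrt_pos.2 hc).ne'
        have h3 : (Fintype.card ι : ℝ) = √(Fintype.card ι : ℝ) * √(Fintype.card ι : ℝ) :=
          (Real.mul_self_sqrt hc.le).symm
        generalize √(Fintype.card ι : ℝ) = s at h2 h3 ⊢
        rw [h3]
        field_simp

theorem abs_expect_le_sqrt {ι : Type*} [Fintype ι] [Nonempty ι] {g e : ι → ℝ} {K E : ℝ}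
    (hK : 0 ≤ K) (he : ∀ i, 0 ≤ e i) (h : ∀ i, |g i| ≤ K * √(e i)) (hE : ∑ i, e i ≤ E) :
    |Finset.univ.expect g| ≤ K * √E := by
  refine (abs_expect_le_div_sqrt hK he h hE).trans ?_
  gcongr
  apply div_le_self hK
  rw [Real.one_le_sqrt]
  exact_mod_cast Fintype.card_pos

theorem abs_expect_sub_expect_le {ι κ : Type*} [Fintype ι] [Nonempty ι] [Fintype κ] [Nonempty κ]
    {g : ι → ℝ} {h : κ → ℝ} {c : ℝ} (H : ∀ i j, |g i - h j| ≤ c) :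
    |Finset.univ.expect g - Finset.univ.expect h| ≤ c := by
  have h1 : ∀ j, |Finset.univ.expect g - h j| ≤ c := fun j => by
    have : Finset.univ.expect g - h j = Finset.univ.expect (fun i => g i - h j) := by
      rw [Finset.expect_sub_distrib, Finset.expect_const Finset.univ_nonempty]
    rw [this]
    refine (Finset.abs_expect_le _ _).trans ?_
    exact Finset.expect_le Finset.univ_nonempty fun i _ => H i j
  have : Finset.univ.expect g - Finset.univ.expect h
      = Finset.univ.expect (fun j => Finset.univ.expect g - h j) := by
    rw [Finset.expect_sub_distrib, Finset.expect_const Finset.univ_nonempty]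
  rw [this]
  refine (Finset.abs_expect_le _ _).trans ?_
  exact Finset.expect_le Finset.univ_nonempty fun j _ => h1 j

/-! ### Elementary moves and energies -/

/-- Some explicit moves of the level groups: a level-`0` move changes the first letter; a level
`j + 1` move skips the initial zeros and the first nonzero letter, and is of level `j` after that. -/
inductive Move {q : ℕ} : ℕ → List (Fin (q + 1)) → List (Fin (q + 1)) → Prop
  | head (x y : Fin (q + 1)) (u : List (Fin (q + 1))) : Move 0 (x :: u) (y :: u)
  | zero {j : ℕ} {u v : List (Fin (q + 1))} : Move (j + 1) u v → Move (j + 1) (0 :: u) (0 :: v)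
  | succ {j : ℕ} {u v : List (Fin (q + 1))} (a : Fin q) : Move j u v →
      Move (j + 1) (a.succ :: u) (a.succ :: v)

theorem Move.append {q j : ℕ} {u v : List (Fin (q + 1))} (h : Move j u v)
    (w : List (Fin (q + 1))) : Move j (u ++ w) (v ++ w) := by
  induction h with
  | head x y u => exact Move.head x y _
  | zero _ ih => exact Move.zero ih
  | succ a _ ih => exact Move.succ a ih

variable {q : ℕ}

open Classical in
/-- The Dirichlet energy of `f` along the level-`j` moves of words of length `n`. -/
noncomputable def levelEnergy (j n : ℕ) (f : List (Fin (q + 1)) → ℝ) : ℝ :=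
  ∑ x : List.Vector (Fin (q + 1)) n, ∑ y : List.Vector (Fin (q + 1)) n,
    if Move j x.1 y.1 then (f x.1 - f y.1) ^ 2 else 0

/-- The Dirichlet energy of `f` along the moves of level less than `K`. -/
noncomputable def energy (K n : ℕ) (f : List (Fin (q + 1)) → ℝ) : ℝ :=
  ∑ j ∈ Finset.range K, levelEnergy j n f

theorem levelEnergy_nonneg (j n : ℕ) (f : List (Fin (q + 1)) → ℝ) : 0 ≤ levelEnergy j n f :=
  Finset.sum_nonneg fun _ _ => Finset.sum_nonneg fun _ _ => by split_ifs <;> positivity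

theorem energy_nonneg (K n : ℕ) (f : List (Fin (q + 1)) → ℝ) : 0 ≤ energy K n f :=
  Finset.sum_nonneg fun _ _ => levelEnergy_nonneg _ _ _

theorem energy_mono {K L : ℕ} (h : K ≤ L) (n : ℕ) (f : List (Fin (q + 1)) → ℝ) :
    energy K n f ≤ energy L n f :=
  Finset.sum_le_sum_of_subset_of_nonneg (Finset.range_subset_range.2 h)
    fun _ _ _ => levelEnergy_nonneg _ _ _

theorem sq_sub_le_levelEnergy {j n : ℕ} {x y : List (Fin (q + 1))} (hx : x.length = n)
    (h : Move j x y) (f : List (Fin (q + 1)) → ℝ) : (f x - f y) ^ 2 ≤ levelEnergy j n f := by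
  classical
  have hy : y.length = n := by
    rw [← hx]
    clear hx
    induction h with
    | head => rfl
    | zero _ ih => simp [ih]
    | succ a _ ih => simp [ih]
  have hn : ∀ x y : List.Vector (Fin (q + 1)) n,
      0 ≤ if Move j x.1 y.1 then (f x.1 - f y.1) ^ 2 else 0 := fun x y => by
    split_ifs <;> positivity
  calc (f x - f y) ^ 2
      = if Move j x y then (f x - f y) ^ 2 else 0 := by rw [if_pos h]
    _ ≤ ∑ y : List.Vector (Fin (q + 1)) n, if Move j x y.1 then (f x - f y.1) ^ 2 else 0 :=
        Finset.single_le_sum (f := fun y : List.Vector (Fin (q + 1)) n =>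
          if Move j x y.1 then (f x - f y.1) ^ 2 else 0)
          (fun y _ => hn ⟨x, hx⟩ y) (Finset.mem_univ ⟨y, hy⟩)
    _ ≤ levelEnergy j n f :=
        Finset.single_le_sum (f := fun x : List.Vector (Fin (q + 1)) n =>
          ∑ y : List.Vector (Fin (q + 1)) n, if Move j x.1 y.1 then (f x.1 - f y.1) ^ 2 else 0)
          (fun x _ => Finset.sum_nonneg fun y _ => hn x y) (Finset.mem_univ ⟨x, hx⟩)

theorem abs_sub_cons_le {K n : ℕ} (hK : 1 ≤ K) {u : List (Fin (q + 1))} (hu : u.length = n)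
    (x y : Fin (q + 1)) (f : List (Fin (q + 1)) → ℝ) :
    |f (x :: u) - f (y :: u)| ≤ √(energy K (n + 1) f) := by
  apply Real.abs_le_sqrt
  refine (sq_sub_le_levelEnergy (n := n + 1) (by simp [hu]) (Move.head x y u) f).trans ?_
  exact Finset.single_le_sum (f := fun j => levelEnergy j (n + 1) f)
    (fun _ _ => levelEnergy_nonneg _ _ _) (Finset.mem_range.2 hK)

/-- A move survives appending a suffix, and edges inside copies with different suffixes are
different, so the copies contribute disjoint parts of the energy. -/
theorem sum_levelEnergy_append_le (j n s : ℕ) (f : List (Fin (q + 1)) → ℝ) :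
    ∑ w : List.Vector (Fin (q + 1)) s, levelEnergy j n (fun u => f (u ++ w.1))
      ≤ levelEnergy j (n + s) f := by
  classical
  unfold levelEnergy
  rw [sum_vector_append n s (fun x => ∑ y : List.Vector (Fin (q + 1)) (n + s),
    if Move j x y.1 then (f x - f y.1) ^ 2 else 0)]
  refine Finset.sum_le_sum fun w _ => Finset.sum_le_sum fun x _ => ?_
  rw [sum_vector_append n s (fun y => if Move j (x.1 ++ w.1) y then
    (f (x.1 ++ w.1) - f y) ^ 2 else 0)]
  refine le_trans ?_ (Finset.single_le_sum (f := fun w' : List.Vector (Fin (q + 1)) s =>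
    ∑ u : List.Vector (Fin (q + 1)) n, if Move j (x.1 ++ w.1) (u.1 ++ w'.1) then
    (f (x.1 ++ w.1) - f (u.1 ++ w'.1)) ^ 2 else 0)
    (fun w' _ => Finset.sum_nonneg fun _ _ => by split_ifs <;> positivity) (Finset.mem_univ w))
  refine Finset.sum_le_sum fun y _ => ?_
  by_cases h : Move j x.1 y.1
  · rw [if_pos h, if_pos (h.append w.1)]
  · rw [if_neg h]; split_ifs <;> positivity

theorem sum_energy_append_le (K n s : ℕ) (f : List (Fin (q + 1)) → ℝ) :
    ∑ w : List.Vector (Fin (q + 1)) s, energy K n (fun u => f (u ++ w.1))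
      ≤ energy K (n + s) f := by
  unfold energy
  rw [Finset.sum_comm]
  exact Finset.sum_le_sum fun j _ => sum_levelEnergy_append_le j n s f

theorem energy_append_le (K n : ℕ) (w : List (Fin (q + 1))) (f : List (Fin (q + 1)) → ℝ) :
    energy K n (fun u => f (u ++ w)) ≤ energy K (n + w.length) f := by
  have key : ∀ (s : ℕ) (v : List.Vector (Fin (q + 1)) s),
      energy K n (fun u => f (u ++ v.1)) ≤ energy K (n + s) f := fun s v =>
    le_trans (Finset.single_le_sum (f := fun w' : List.Vector (Fin (q + 1)) s =>
      energy K n (fun u => f (u ++ w'.1))) (fun _ _ => energy_nonneg _ _ _) (Finset.mem_univ v))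
      (sum_energy_append_le K n s f)
  exact key w.length ⟨w, rfl⟩

theorem sum_energy_concat_le (K n : ℕ) (f : List (Fin (q + 1)) → ℝ) :
    ∑ c : Fin (q + 1), energy K n (fun u => f (u ++ [c])) ≤ energy K (n + 1) f := by
  refine le_trans (le_of_eq ?_) (sum_energy_append_le K n 1 f)
  exact (sum_vector_one (fun w => energy K n (fun u => f (u ++ w)))).symm

theorem energy_concat_add_le (K n : ℕ) (c : Fin (q + 1)) (f : List (Fin (q + 1)) → ℝ) :
    energy K n (fun u => f (u ++ [c]))
      + ∑ i : Fin q, energy K n (fun u => f (u ++ [c.succAbove i])) ≤ energy K (n + 1) f := by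
  refine le_trans (le_of_eq ?_) (sum_energy_concat_le K n f)
  exact (Fin.sum_univ_succAbove (fun c => energy K n (fun u => f (u ++ [c]))) c).symm

/-! ### Moves behind a prefix -/

/-- The word `0ⁱ a u` with `a` a nonzero letter. -/
def zerosCons (i : ℕ) (a : Fin q) (u : List (Fin (q + 1))) : List (Fin (q + 1)) :=
  List.replicate i 0 ++ a.succ :: u

theorem zerosCons_append (i : ℕ) (a : Fin q) (u w : List (Fin (q + 1))) :
    zerosCons i a u ++ w = zerosCons i a (u ++ w) := by simp [zerosCons]

@[simp] theorem length_zerosCons (i : ℕ) (a : Fin q) (u : List (Fin (q + 1))) :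
    (zerosCons i a u).length = i + 1 + u.length := by simp [zerosCons]; omega

/-- A leading zero is transparent to a level, a leading nonzero letter uses up one level; the edges
that fix different first letters are disjoint. -/
theorem levelEnergy_cons_le (j n : ℕ) (f : List (Fin (q + 1)) → ℝ) :
    levelEnergy (j + 1) n (fun u => f (0 :: u))
      + ∑ a : Fin q, levelEnergy j n (fun u => f (a.succ :: u)) ≤ levelEnergy (j + 1) (n + 1) f := by
  classical
  have key : ∀ (k : ℕ) (c : Fin (q + 1)),
      (∀ u v : List (Fin (q + 1)), Move k u v → Move (j + 1) (c :: u) (c :: v)) →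
      levelEnergy k n (fun u => f (c :: u)) ≤ ∑ u : List.Vector (Fin (q + 1)) n,
        ∑ y : List.Vector (Fin (q + 1)) (n + 1),
          if Move (j + 1) (c :: u.1) y.1 then (f (c :: u.1) - f y.1) ^ 2 else 0 := by
    intro k c hc
    refine Finset.sum_le_sum fun x _ => ?_
    rw [sum_vector_cons n (fun y => if Move (j + 1) (c :: x.1) y then
      (f (c :: x.1) - f y) ^ 2 else 0)]
    refine le_trans ?_ (Finset.single_le_sum (f := fun c' : Fin (q + 1) =>
      ∑ u : List.Vector (Fin (q + 1)) n, if Move (j + 1) (c :: x.1) (c' :: u.1) then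
      (f (c :: x.1) - f (c' :: u.1)) ^ 2 else 0)
      (fun w' _ => Finset.sum_nonneg fun _ _ => by split_ifs <;> positivity) (Finset.mem_univ c))
    refine Finset.sum_le_sum fun y _ => ?_
    by_cases h : Move k x.1 y.1
    · rw [if_pos h, if_pos (hc _ _ h)]
    · rw [if_neg h]; split_ifs <;> positivity
  conv_rhs => unfold levelEnergy
  rw [sum_vector_cons n (fun x => ∑ y : List.Vector (Fin (q + 1)) (n + 1),
    if Move (j + 1) x y.1 then (f x - f y.1) ^ 2 else 0), Fin.sum_univ_succ]
  exact add_le_add (key _ 0 fun u v h => h.zero)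
    (Finset.sum_le_sum fun a _ => key _ a.succ fun u v h => h.succ a)

theorem sum_levelEnergy_zerosCons_le (j : ℕ) {n N : ℕ} (hN : N ≤ n)
    (f : List (Fin (q + 1)) → ℝ) :
    ∑ i ∈ Finset.range N, ∑ a : Fin q, levelEnergy j (n - (i + 1)) (fun u => f (zerosCons i a u))
      ≤ levelEnergy (j + 1) n f := by
  induction N generalizing n f with
  | zero => simpa using levelEnergy_nonneg _ _ _
  | succ N ih =>
    obtain ⟨n, rfl⟩ : ∃ n', n = n' + 1 := ⟨n - 1, by omega⟩
    rw [Finset.sum_range_succ']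
    refine le_trans (add_le_add ?_ (le_of_eq ?_)) (levelEnergy_cons_le j n f)
    · refine le_trans (le_of_eq ?_) (ih (n := n) (by omega) (fun u => f (0 :: u)))
      refine Finset.sum_congr rfl fun i _ => Finset.sum_congr rfl fun a _ => ?_
      rw [Nat.add_sub_add_right]
      rfl
    · rfl

/-- This is how an estimate in one degree feeds the next: behind the disjoint prefixes 0ⁱa the
network is that of one degree less. -/
theorem sum_energy_zerosCons_le (K : ℕ) {n N : ℕ} (hN : N ≤ n) (f : List (Fin (q + 1)) → ℝ) :
    ∑ i ∈ Finset.range N, ∑ a : Fin q, energy K (n - (i + 1)) (fun u => f (zerosCons i a u))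
      ≤ energy (K + 1) n f := by
  unfold energy
  rw [Finset.sum_range_succ']
  refine le_trans ?_ (le_add_of_nonneg_right (levelEnergy_nonneg _ _ _))
  simp_rw [Finset.sum_comm (s := Finset.univ (α := Fin q)) (t := Finset.range K)]
  rw [Finset.sum_comm]
  exact Finset.sum_le_sum fun j _ => sum_levelEnergy_zerosCons_le j hN f

theorem energy_zerosCons_le (K i n : ℕ) (f : List (Fin (q + 1)) → ℝ) :
    ∑ a : Fin q, energy K n (fun u => f (zerosCons i a u)) ≤ energy (K + 1) (i + 1 + n) f := by
  refine le_trans ?_ (sum_energy_zerosCons_le K (n := i + 1 + n) (N := i + 1) (by omega) f)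
  refine le_trans (le_of_eq ?_) (Finset.single_le_sum (f := fun i' =>
    ∑ a : Fin q, energy K (i + 1 + n - (i' + 1)) (fun u => f (zerosCons i' a u)))
    (fun _ _ => Finset.sum_nonneg fun _ _ => energy_nonneg _ _ _)
    (Finset.mem_range.2 (Nat.lt_succ_self i)))
  simp

/-- All resistances between words of length `n` along moves of level less than `K` are bounded by
a multiple of `ρ ^ 2`, in dual form. -/
def ResBound (q K n : ℕ) (ρ : ℝ) : Prop :=
  ∀ (f : List (Fin (q + 1)) → ℝ) (x y : List (Fin (q + 1))), x.length = n → y.length = n →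
    |f x - f y| ≤ ρ * √(energy K n f)

theorem ResBound.mono {K L n : ℕ} {ρ σ : ℝ} (h : ResBound q K n ρ) (hKL : K ≤ L) (hρ : ρ ≤ σ)
    (h0 : 0 ≤ σ) : ResBound q L n σ := fun f x y hx hy =>
  (h f x y hx hy).trans (mul_le_mul hρ (Real.sqrt_le_sqrt (energy_mono hKL n f))
    (Real.sqrt_nonneg _) h0)


/-! ### Degree zero -/

/-- The resistance growth factor `m / (m - 1)` in degree zero. -/
noncomputable def growth (q : ℕ) : ℝ := 1 + 1 / q

theorem one_lt_growth (hq : 1 ≤ q) : 1 < growth q := by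
  unfold growth
  have : (0 : ℝ) < q := by exact_mod_cast hq
  have := one_div_pos.2 this
  linarith

theorem one_lt_sqrt_growth (hq : 1 ≤ q) : 1 < √(growth q) := by
  rw [Real.lt_sqrt zero_le_one]
  simpa using one_lt_growth hq

/-- Append a last letter. In the section 0 the hypothesis costs r; averaged over the q nonzero
sections it costs r/√q; by Cauchy–Schwarz on the disjoint energies the two combine to r√(1 + 1/q).
The sections are joined behind 0ⁿa by changing the last letter, at cost 1. -/
theorem abs_replicate_sub_expect_step {n : ℕ} {r : ℝ} (hq : 1 ≤ q) (hr : 0 ≤ r)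
    (h : ∀ f : List (Fin (q + 1)) → ℝ,
      |f (List.replicate (n + 1) 0) - 𝔼 a : Fin q, f (zerosCons n a [])|
        ≤ r * √(energy 2 (n + 1) f)) (f : List (Fin (q + 1)) → ℝ) :
    |f (List.replicate (n + 2) 0) - 𝔼 a : Fin q, f (zerosCons (n + 1) a [])|
      ≤ (√(growth q) * r + 1) * √(energy 2 (n + 2) f) := by
  have : Nonempty (Fin q) := ⟨⟨0, hq⟩⟩
  have hz : ∀ c : Fin (q + 1), ∀ a : Fin q, zerosCons n a [] ++ [c] = zerosCons n a [c] :=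
    fun c a => by simp [zerosCons]
  have h0 := h (fun u => f (u ++ [0]))
  have h1 : ∀ b : Fin q, _ := fun b => h (fun u => f (u ++ [b.succ]))
  simp only [hz] at h0 h1
  have e1 : (List.replicate (n + 1) 0 : List (Fin (q + 1))) ++ [0] = List.replicate (n + 2) 0 :=
    List.replicate_succ'.symm
  have e2 : ∀ b : Fin q, (List.replicate (n + 1) 0 : List (Fin (q + 1))) ++ [b.succ]
      = zerosCons (n + 1) b [] := fun b => by simp [zerosCons]
  rw [e1] at h0
  simp only [e2] at h1
  set E0 := energy 2 (n + 1) (fun u => f (u ++ [0]))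
  set E1 : Fin q → ℝ := fun b => energy 2 (n + 1) (fun u => f (u ++ [b.succ]))
  have hE : E0 + ∑ b, E1 b ≤ energy 2 (n + 2) f := by
    have := energy_concat_add_le 2 (n + 1) 0 f
    simpa only [Fin.succAbove_zero] using this
  have h2 : |𝔼 b : Fin q, (f (zerosCons (n + 1) b []) - 𝔼 a : Fin q, f (zerosCons n a [b.succ]))|
      ≤ r / √(Fintype.card (Fin q)) * √(∑ b, E1 b) :=
    abs_expect_le_div_sqrt (e := E1) hr (fun _ => energy_nonneg _ _ _) h1 le_rfl
  have h3 : |𝔼 a : Fin q, (f (zerosCons n a [0]) - 𝔼 b : Fin q, f (zerosCons n a [b.succ]))|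
      ≤ 1 * √(energy 2 (n + 2) f) := by
    refine abs_expect_le_sqrt (e := fun a => energy 1 1 (fun u => f (zerosCons n a u)))
      zero_le_one (fun _ => energy_nonneg _ _ _) (fun a => ?_) (energy_zerosCons_le 1 n 1 f)
    rw [one_mul]
    have := abs_expect_sub_expect_le (ι := Unit) (κ := Fin q) (g := fun _ => f (zerosCons n a [0]))
      (h := fun b => f (zerosCons n a [b.succ])) (fun _ b =>
      abs_sub_cons_le (K := 1) (n := 0) le_rfl (u := []) rfl 0 b.succ
        (fun u => f (zerosCons n a u)))
    simpa using this
  rw [Finset.expect_sub_distrib] at h2 h3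
  rw [Finset.expect_comm] at h3
  have h4 : r * √E0 + r / √(Fintype.card (Fin q)) * √(∑ b, E1 b)
      ≤ √(growth q) * r * √(energy 2 (n + 2) f) := by
    have := sqrt_mul_add_sqrt_mul_le (a := 1) (b := 1 / (q : ℝ)) zero_le_one (by positivity)
      (energy_nonneg 2 (n + 1) (fun u => f (u ++ [0])) : 0 ≤ E0)
      (Finset.sum_nonneg fun b _ => energy_nonneg _ _ _ : 0 ≤ ∑ b, E1 b)
    rw [Real.sqrt_one, one_mul, Real.sqrt_div zero_le_one, Real.sqrt_one] at this
    calc _ = r * (√E0 + 1 / √q * √(∑ b, E1 b)) := by rw [Fintype.card_fin]; ring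
      _ ≤ r * (√(growth q) * √(energy 2 (n + 2) f)) := by
        gcongr
        refine this.trans ?_
        unfold growth
        gcongr
      _ = _ := by ring
  rw [abs_le] at *
  constructor <;> linarith [h0.1, h0.2, h2.1, h2.2, h3.1, h3.2]

theorem abs_replicate_sub_expect_le (hq : 1 ≤ q) (n : ℕ) (f : List (Fin (q + 1)) → ℝ) :
    |f (List.replicate (n + 1) 0) - 𝔼 a : Fin q, f (zerosCons n a [])|
      ≤ ((1 + 1 / (√(growth q) - 1)) * √(growth q) ^ n) * √(energy 2 (n + 1) f) := by
  have hμ := one_lt_sqrt_growth hq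
  set μ := √(growth q) with hμ_def
  have hD : 0 < 1 / (μ - 1) := one_div_pos.2 (by linarith)
  have hDμ : 1 / (μ - 1) * μ = 1 / (μ - 1) + 1 := by
    have : μ - 1 ≠ 0 := by linarith
    field_simp
    ring
  set D := 1 / (μ - 1)
  -- The solution of r ↦ μr + 1 with initial value 1; its fixed point is -D.
  have key : ∀ f : List (Fin (q + 1)) → ℝ,
      |f (List.replicate (n + 1) 0) - 𝔼 a : Fin q, f (zerosCons n a [])|
        ≤ ((1 + D) * μ ^ n - D) * √(energy 2 (n + 1) f) := by
    induction n with
    | zero =>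
      intro f
      have : Nonempty (Fin q) := ⟨⟨0, hq⟩⟩
      have := abs_expect_sub_expect_le (ι := Unit) (κ := Fin q) (g := fun _ => f [0])
        (h := fun b => f [b.succ]) (fun _ b =>
        abs_sub_cons_le (K := 2) (n := 0) one_le_two (u := []) rfl 0 b.succ f)
      simpa [zerosCons] using this
    | succ n ih =>
      intro f
      have hn : 1 ≤ μ ^ n := one_le_pow₀ hμ.le
      refine (abs_replicate_sub_expect_step hq (by nlinarith) ih f).trans (le_of_eq ?_)
      congr 1
      rw [← hμ_def, pow_succ]
      linear_combination -hDμ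
  refine (key f).trans ?_
  gcongr
  linarith

/-- Induction on the last letter c: reach 0ⁿ⁺¹c inside its section, then use the corner estimate
twice to pass through the words 0ⁿac and 0ⁿa0 to 0ⁿ⁺². The extra cost is geometric in n, so the sum
is of the order of its last term. -/
theorem abs_sub_replicate_le (hq : 1 ≤ q) (n : ℕ) (f : List (Fin (q + 1)) → ℝ)
    (x : List (Fin (q + 1))) (hx : x.length = n) :
    |f x - f (List.replicate n 0)| ≤ (3 * (1 + 1 / (√(growth q) - 1)) * (1 / (√(growth q) - 1))
      * √(growth q) ^ n) * √(energy 2 n f) := by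
  have hμ := one_lt_sqrt_growth hq
  have : Nonempty (Fin q) := ⟨⟨0, hq⟩⟩
  have corner := abs_replicate_sub_expect_le hq
  set μ := √(growth q) with hμ_def
  have hD : 0 < 1 / (μ - 1) := one_div_pos.2 (by linarith)
  have hDμ : 1 / (μ - 1) * μ = 1 / (μ - 1) + 1 := by
    have : μ - 1 ≠ 0 := by linarith
    field_simp
    ring
  set D := 1 / (μ - 1)
  induction n generalizing f x with
  | zero =>
    rw [List.length_eq_zero_iff] at hx
    subst hx
    simp
    positivity
  | succ n ih =>
    rcases n with _ | n
    · obtain ⟨c, rfl⟩ := List.length_eq_one_iff.1 hx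
      refine (abs_sub_cons_le (K := 2) (n := 0) one_le_two (u := []) rfl c 0 f).trans ?_
      rw [zero_add, pow_one]
      refine le_mul_of_one_le_left (Real.sqrt_nonneg _) ?_
      have : 3 * (1 + D) * D * μ = 3 * (1 + D) * (D + 1) := by rw [mul_assoc, hDμ]
      rw [this]
      nlinarith
    · obtain ⟨y, c, rfl⟩ : ∃ y c, x = y ++ [c] :=
        ⟨x.dropLast, x.getLast (by rintro rfl; simp at hx), (List.dropLast_append_getLast _).symm⟩
      have hy : y.length = n + 1 := by simpa using hx
      have hz : ∀ c : Fin (q + 1), ∀ a : Fin q, zerosCons n a [] ++ [c] = zerosCons n a [c] :=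
        fun c a => by simp [zerosCons]
      have suf : ∀ c : Fin (q + 1), √(energy 2 (n + 1) (fun u => f (u ++ [c])))
          ≤ √(energy 2 (n + 2) f) := fun c =>
        Real.sqrt_le_sqrt (energy_append_le 2 (n + 1) [c] f)
      have h1 := ih (fun u => f (u ++ [c])) y hy
      have h2 := corner n (fun u => f (u ++ [c]))
      have h3 := corner n (fun u => f (u ++ [0]))
      have h4 : |𝔼 a : Fin q, (f (zerosCons n a [c]) - f (zerosCons n a [0]))|
          ≤ 1 * √(energy 2 (n + 2) f) := by
        refine abs_expect_le_sqrt (e := fun a => energy 1 1 (fun u => f (zerosCons n a u)))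
          zero_le_one (fun _ => energy_nonneg _ _ _) (fun a => ?_) (energy_zerosCons_le 1 n 1 f)
        rw [one_mul]
        exact abs_sub_cons_le (K := 1) (n := 0) le_rfl (u := []) rfl c 0
          (fun u => f (zerosCons n a u))
      rw [Finset.expect_sub_distrib] at h4
      simp only [hz] at h2 h3
      have e1 : (List.replicate (n + 1) 0 : List (Fin (q + 1))) ++ [0]
        = List.replicate (n + 1 + 1) 0 := List.replicate_succ'.symm
      rw [e1] at h3
      have hμn : 1 ≤ μ ^ (n + 1) := one_le_pow₀ hμ.le
      have hμn' : μ ^ n ≤ μ ^ (n + 1) := pow_le_pow_right₀ hμ.le (Nat.le_succ n)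
      set E := √(energy 2 (n + 2) f)
      have hE : 0 ≤ E := Real.sqrt_nonneg _
      have h1' := h1.trans (mul_le_mul_of_nonneg_left (suf c) (by positivity))
      have h2' := h2.trans (mul_le_mul_of_nonneg_left (suf c) (by positivity))
      have h3' := h3.trans (mul_le_mul_of_nonneg_left (suf 0) (by positivity))
      -- Since D(μ - 1) = 1, passing from n + 1 to n + 2 raises the bound by 3(1 + D)μⁿ⁺¹, which
      -- pays for two corners and one unit move.
      have h5 : (3 * (1 + D) * D * μ ^ (n + 1)) * E + (1 + D) * μ ^ n * E + (1 + D) * μ ^ n * E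
          + 1 * E ≤ 3 * (1 + D) * D * μ ^ (n + 1 + 1) * E := by
        rw [← add_mul, ← add_mul, ← add_mul]
        refine mul_le_mul_of_nonneg_right ?_ hE
        have : 3 * (1 + D) * D * μ ^ (n + 1 + 1) = 3 * (1 + D) * μ ^ (n + 1) * (D + 1) := by
          rw [← hDμ]; ring
        rw [this]
        nlinarith
      rw [abs_le] at *
      constructor <;> linarith [h1'.1, h1'.2, h2'.1, h2'.2, h3'.1, h3'.2, h4.1, h4.2]

theorem exists_resBound_two (hq : 1 ≤ q) :
    ∃ A : ℝ, 0 < A ∧ ∀ n, ResBound q 2 n (A * √(growth q) ^ n) := by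
  have hμ := one_lt_sqrt_growth hq
  have hD : 0 < 1 / (√(growth q) - 1) := one_div_pos.2 (by linarith)
  refine ⟨6 * (1 + 1 / (√(growth q) - 1)) * (1 / (√(growth q) - 1)), by positivity,
    fun n f x y hx hy => ?_⟩
  have h1 := abs_sub_replicate_le hq n f x hx
  have h2 := abs_sub_replicate_le hq n f y hy
  rw [abs_le] at *
  constructor <;> linarith [h1.1, h1.2, h2.1, h2.2]


/-! ### Degree one -/

theorem abs_expect_zerosCons_sub_le {ι κ : Type*} [Fintype ι] [Nonempty ι] [Fintype κ] [Nonempty κ]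
    {K L : ℕ} {ρ : ℝ} (hq : 1 ≤ q) (h0 : 0 ≤ ρ) (hρ : ResBound q K L ρ) (M : ℕ)
    (u : ι → List (Fin (q + 1))) (v : κ → List (Fin (q + 1))) (hu : ∀ t, (u t).length = L)
    (hv : ∀ t, (v t).length = L) (f : List (Fin (q + 1)) → ℝ) :
    |(𝔼 a : Fin q, 𝔼 t, f (zerosCons M a (u t))) - 𝔼 a : Fin q, 𝔼 t, f (zerosCons M a (v t))|
      ≤ ρ * √(∑ a : Fin q, energy K L (fun w => f (zerosCons M a w))) := by
  have : Nonempty (Fin q) := ⟨⟨0, hq⟩⟩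
  rw [← Finset.expect_sub_distrib]
  exact abs_expect_le_sqrt (e := fun a => energy K L (fun w => f (zerosCons M a w))) h0
    (fun _ => energy_nonneg _ _ _)
    (fun a => abs_expect_sub_expect_le fun i j =>
      hρ (fun w => f (zerosCons M a w)) _ _ (hu i) (hv j)) le_rfl

/-- A word of length `k + 1` whose last letter differs from `c`. -/
def tailWord {k : ℕ} (c : Fin (q + 1)) (t : List.Vector (Fin (q + 1)) k × Fin q) :
    List (Fin (q + 1)) :=
  t.1.1 ++ [c.succAbove t.2]

theorem length_tailWord {k : ℕ} (c : Fin (q + 1)) (t : List.Vector (Fin (q + 1)) k × Fin q) :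
    (tailWord c t).length = k + 1 := by
  simp only [tailWord, List.length_append, List.length_singleton]
  rw [t.1.2]

/-- The average of `f` over the words `0^M a v` with `a ≠ 0` and `v` a word of length `k + 1` whose
last letter differs from `c`. -/
noncomputable def spread (M k : ℕ) (c : Fin (q + 1)) (f : List (Fin (q + 1)) → ℝ) : ℝ :=
  𝔼 a : Fin q, 𝔼 t : List.Vector (Fin (q + 1)) k × Fin q, f (zerosCons M a (tailWord c t))

theorem nonempty_tails (hq : 1 ≤ q) (k : ℕ) :
    Nonempty (List.Vector (Fin (q + 1)) k × Fin q) :=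
  ⟨List.Vector.replicate k 0, ⟨0, hq⟩⟩

/-- The suffixes b·v, with b nonzero and last letter different from c, are distinct, and the
estimate keeps the section of c unused. The proof discards the suffixes that start with b = 0. -/
theorem sum_energy_tailWord_le (K n k : ℕ) (c : Fin (q + 1)) (f : List (Fin (q + 1)) → ℝ) :
    ∑ p : Fin q × (List.Vector (Fin (q + 1)) k × Fin q),
      energy K n (fun u => f (u ++ p.1.succ :: tailWord c p.2))
      ≤ ∑ i : Fin q, energy K (n + (k + 1)) (fun u => f (u ++ [c.succAbove i])) := by
  rw [Fintype.sum_prod_type]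
  simp_rw [Fintype.sum_prod_type]
  have : ∀ b : Fin q, ∑ v : List.Vector (Fin (q + 1)) k, ∑ i : Fin q,
      energy K n (fun u => f (u ++ b.succ :: tailWord c (v, i)))
      = ∑ i : Fin q, ∑ v : List.Vector (Fin (q + 1)) k,
      energy K n (fun u => f (u ++ b.succ :: tailWord c (v, i))) := fun b => Finset.sum_comm
  simp_rw [this]
  rw [Finset.sum_comm]
  refine Finset.sum_le_sum fun i _ => ?_
  refine le_trans ?_ (sum_energy_append_le K n (k + 1) (fun u => f (u ++ [c.succAbove i])))
  rw [sum_vector_cons k (fun w => energy K n (fun u => f (u ++ w ++ [c.succAbove i]))),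
    Fin.sum_univ_succ]
  refine le_add_of_nonneg_of_le (Finset.sum_nonneg fun _ _ => energy_nonneg _ _ _) (le_of_eq ?_)
  refine Finset.sum_congr rfl fun b _ => Finset.sum_congr rfl fun v _ => ?_
  simp [tailWord]

/-- Two moves. Behind 0ᴹa, rearrange the last k + 2 letters into b·v, at lower-degree cost ρ. Then,
with the suffix b·v fixed, pass from the words 0ᴹa to 0ᴹ⁺¹ by the corner estimate, averaged over at
least (q + 1)ᵏ suffixes. Requiring the last letter of v to differ from c' makes the second energy
disjoint from the section c' used before. -/
theorem abs_spread_sub_spread_succ_le {M k : ℕ} {ρ D : ℝ} (hq : 1 ≤ q) (h0 : 0 ≤ ρ)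
    (hρ : ResBound q 2 (k + 2) ρ) (hD0 : 0 ≤ D)
    (hD : ∀ f : List (Fin (q + 1)) → ℝ,
      |f (List.replicate (M + 1) 0) - 𝔼 a : Fin q, f (zerosCons M a [])|
        ≤ D * √(energy 3 (M + 1) f)) (c c' : Fin (q + 1)) (f : List (Fin (q + 1)) → ℝ) :
    |spread M k c (fun u => f (u ++ [c'])) - spread (M + 1) k c' f|
      ≤ ρ * √(∑ a : Fin q, energy 2 (k + 2) (fun w => f (zerosCons M a w)))
        + D / √((q + 1 : ℝ) ^ k) * √(∑ i : Fin q, energy 3 (M + 1 + (k + 1))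
            (fun u => f (u ++ [c'.succAbove i]))) := by
  have : Nonempty (Fin q) := ⟨⟨0, hq⟩⟩
  have := nonempty_tails hq k
  have h1 := abs_expect_zerosCons_sub_le hq h0 hρ M
    (fun t : List.Vector (Fin (q + 1)) k × Fin q => tailWord c t ++ [c'])
    (fun p : Fin q × (List.Vector (Fin (q + 1)) k × Fin q) => p.1.succ :: tailWord c' p.2)
    (fun t => by simp [length_tailWord]) (fun t => by simp [length_tailWord]) f
  have h2 : |𝔼 p : Fin q × (List.Vector (Fin (q + 1)) k × Fin q),
      (f (zerosCons (M + 1) p.1 (tailWord c' p.2))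
        - 𝔼 a : Fin q, f (zerosCons M a (p.1.succ :: tailWord c' p.2)))|
      ≤ D / √(Fintype.card (Fin q × (List.Vector (Fin (q + 1)) k × Fin q)))
        * √(∑ i : Fin q, energy 3 (M + 1 + (k + 1)) (fun u => f (u ++ [c'.succAbove i]))) := by
    refine abs_expect_le_div_sqrt
      (e := fun p => energy 3 (M + 1) (fun u => f (u ++ p.1.succ :: tailWord c' p.2)))
      hD0 (fun _ => energy_nonneg _ _ _) (fun p => ?_) (sum_energy_tailWord_le 3 (M + 1) k c' f)
    have := hD (fun u => f (u ++ p.1.succ :: tailWord c' p.2))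
    have e : (List.replicate (M + 1) 0 ++ p.1.succ :: tailWord c' p.2 : List (Fin (q + 1)))
        = zerosCons (M + 1) p.1 (tailWord c' p.2) := rfl
    simp only [zerosCons_append, List.nil_append, e] at this
    exact this
  rw [Finset.expect_sub_distrib, Finset.expect_comm] at h2
  have h3 : (𝔼 p : Fin q × (List.Vector (Fin (q + 1)) k × Fin q),
      f (zerosCons (M + 1) p.1 (tailWord c' p.2))) = spread (M + 1) k c' f :=
    Finset.expect_product Finset.univ Finset.univ
      (fun p : Fin q × (List.Vector (Fin (q + 1)) k × Fin q) =>
        f (zerosCons (M + 1) p.1 (tailWord c' p.2)))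
  rw [h3] at h2
  have h4 : spread M k c (fun u => f (u ++ [c']))
      = 𝔼 a : Fin q, 𝔼 t : List.Vector (Fin (q + 1)) k × Fin q,
        f (zerosCons M a (tailWord c t ++ [c'])) := by
    simp only [spread, zerosCons_append]
  rw [← h4] at h1
  have h5 : D / √(Fintype.card (Fin q × (List.Vector (Fin (q + 1)) k × Fin q)))
      ≤ D / √((q + 1 : ℝ) ^ k) := by
    have : (0 : ℝ) < √((q + 1 : ℝ) ^ k) := Real.sqrt_pos.2 (by positivity)
    gcongr
    simp only [Fintype.card_prod, Fintype.card_fin, card_vector]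
    push_cast
    have h6 : (1 : ℝ) ≤ q := by exact_mod_cast hq
    calc (q + 1 : ℝ) ^ k = 1 * ((q + 1 : ℝ) ^ k * 1) := by ring
      _ ≤ q * ((q + 1 : ℝ) ^ k * q) := by gcongr
  have h7 := h2.trans (mul_le_mul_of_nonneg_right h5 (Real.sqrt_nonneg _))
  rw [abs_le] at *
  constructor <;> linarith [h1.1, h1.2, h7.1, h7.2]

/-- Iterates the previous step. The energies used for different M are disjoint, so M steps cost √M
rather than M, both for the rearrangements and for the corners. -/
theorem abs_sub_spread_le {k : ℕ} {ρ D : ℝ} (hq : 1 ≤ q) (h0 : 0 ≤ ρ)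
    (hρ : ResBound q 2 (k + 2) ρ) (hD0 : 0 ≤ D) (M : ℕ)
    (hD : ∀ n < M, ∀ f : List (Fin (q + 1)) → ℝ,
      |f (List.replicate (n + 1) 0) - 𝔼 a : Fin q, f (zerosCons n a [])|
        ≤ D * √(energy 3 (n + 1) f)) (f : List (Fin (q + 1)) → ℝ) (y : List (Fin (q + 1)))
    (c : Fin (q + 1)) (hy : y.length = M + 1 + k) :
    |f (y ++ [c]) - spread M k c f| ≤ ρ * √(energy 3 (M + 1 + k + 1) f)
      + ρ * (√M * √(∑ i ∈ Finset.range M, ∑ a : Fin q,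
          energy 2 (M + 1 + k + 1 - (i + 1)) (fun u => f (zerosCons i a u))))
      + D / √((q + 1 : ℝ) ^ k) * (√M * √(energy 3 (M + 1 + k + 1) f)) := by
  have : Nonempty (Fin q) := ⟨⟨0, hq⟩⟩
  have := nonempty_tails hq k
  have hβ : 0 ≤ D / √((q + 1 : ℝ) ^ k) := by positivity
  induction M generalizing f y c with
  | zero =>
    simp only [Nat.cast_zero, Real.sqrt_zero, zero_mul, mul_zero, add_zero]
    have h1 : ∀ a : Fin q, |f (y ++ [c]) - 𝔼 t : List.Vector (Fin (q + 1)) k × Fin q,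
        f (zerosCons 0 a (tailWord c t))| ≤ ρ * √(energy 3 (0 + 1 + k + 1) f) := fun a => by
      have := abs_expect_sub_expect_le (ι := Unit) (g := fun _ => f (y ++ [c]))
        (h := fun t : List.Vector (Fin (q + 1)) k × Fin q => f (zerosCons 0 a (tailWord c t)))
        (c := ρ * √(energy 3 (0 + 1 + k + 1) f)) (fun _ t =>
        hρ.mono (L := 3) (by norm_num) le_rfl h0 f (y ++ [c]) _ (by simp [hy]; omega)
          (by simp [length_tailWord]; omega) |>.trans (le_of_eq (by congr 3; omega)))
      simpa using this
    have := abs_expect_sub_expect_le (ι := Unit) (g := fun _ => f (y ++ [c])) (fun _ a => h1 a)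
    simpa [spread] using this
  | succ M ih =>
    obtain ⟨z, c', rfl⟩ : ∃ z c', y = z ++ [c'] :=
      ⟨y.dropLast, y.getLast (by rintro rfl; simp at hy; omega),
        (List.dropLast_append_getLast _).symm⟩
    have hz : z.length = M + 1 + k := by simp at hy; omega
    have h1 := ih (fun n hn => hD n (by omega)) (fun u => f (u ++ [c])) z c' hz
    have h2 := abs_spread_sub_spread_succ_le hq h0 hρ hD0 (hD M (Nat.lt_succ_self M)) c' c f
    have en : M + 1 + 1 + k + 1 = M + 1 + k + 1 + 1 := by omega
    have en' : M + 1 + (k + 1) = M + 1 + k + 1 := by omega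
    rw [en'] at h2
    rw [en]
    set E0 := energy 3 (M + 1 + k + 1) (fun u => f (u ++ [c]))
    set E1 := ∑ i : Fin q, energy 3 (M + 1 + k + 1) (fun u => f (u ++ [c.succAbove i]))
    set E := energy 3 (M + 1 + k + 1 + 1) f
    set Q0 := ∑ i ∈ Finset.range M, ∑ a : Fin q,
      energy 2 (M + 1 + k + 1 - (i + 1)) (fun u => f (zerosCons i a u ++ [c]))
    set Q1 := ∑ a : Fin q, energy 2 (k + 2) (fun w => f (zerosCons M a w))
    have hE0 : 0 ≤ E0 := energy_nonneg _ _ _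
    have hE1 : 0 ≤ E1 := Finset.sum_nonneg fun _ _ => energy_nonneg _ _ _
    have hQ0 : 0 ≤ Q0 :=
      Finset.sum_nonneg fun _ _ => Finset.sum_nonneg fun _ _ => energy_nonneg _ _ _
    have hQ1 : 0 ≤ Q1 := Finset.sum_nonneg fun _ _ => energy_nonneg _ _ _
    have hE : E0 + E1 ≤ E := energy_concat_add_le 3 (M + 1 + k + 1) c f
    have hQ : Q0 + Q1 ≤ ∑ i ∈ Finset.range (M + 1), ∑ a : Fin q,
        energy 2 (M + 1 + k + 1 + 1 - (i + 1)) (fun u => f (zerosCons i a u)) := by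
      rw [Finset.sum_range_succ]
      refine add_le_add (Finset.sum_le_sum fun i hi => Finset.sum_le_sum fun a _ => ?_)
        (le_of_eq ?_)
      · have hi' := Finset.mem_range.1 hi
        have := energy_append_le 2 (M + 1 + k + 1 - (i + 1)) [c] (fun u => f (zerosCons i a u))
        rw [List.length_singleton, show M + 1 + k + 1 - (i + 1) + 1
          = M + 1 + k + 1 + 1 - (i + 1) by omega] at this
        simpa only [zerosCons_append] using this
      · rw [show M + 1 + k + 1 + 1 - (M + 1) = k + 2 by omega]
    have s1 : ρ * √E0 ≤ ρ * √E := by gcongr; linarith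
    have s2 : ρ * (√M * √Q0) + ρ * √Q1 ≤ ρ * (√((M + 1 : ℕ) : ℝ)
        * √(∑ i ∈ Finset.range (M + 1), ∑ a : Fin q,
          energy 2 (M + 1 + k + 1 + 1 - (i + 1)) (fun u => f (zerosCons i a u)))) := by
      rw [← mul_add]
      refine mul_le_mul_of_nonneg_left ?_ h0
      have := sqrt_mul_add_sqrt_mul_le (Nat.cast_nonneg M) zero_le_one hQ0 hQ1
      rw [Real.sqrt_one, one_mul] at this
      refine this.trans ?_
      rw [Nat.cast_add, Nat.cast_one]
      exact mul_le_mul_of_nonneg_left (Real.sqrt_le_sqrt hQ) (Real.sqrt_nonneg _)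
    have s3 : D / √((q + 1 : ℝ) ^ k) * (√M * √E0) + D / √((q + 1 : ℝ) ^ k) * √E1
        ≤ D / √((q + 1 : ℝ) ^ k) * (√((M + 1 : ℕ) : ℝ) * √E) := by
      rw [← mul_add]
      refine mul_le_mul_of_nonneg_left ?_ hβ
      have := sqrt_mul_add_sqrt_mul_le (Nat.cast_nonneg M) zero_le_one hE0 hE1
      rw [Real.sqrt_one, one_mul] at this
      refine this.trans ?_
      rw [Nat.cast_add, Nat.cast_one]
      exact mul_le_mul_of_nonneg_left (Real.sqrt_le_sqrt hE) (Real.sqrt_nonneg _)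
    rw [abs_le] at *
    constructor <;> linarith [h1.1, h1.2, h2.1, h2.2]

/-- Bootstrap: the corner constant needed for M follows from the conclusion for smaller M, by
joining the sections of two last letters through their spreads. The condition on k shrinks that
contribution enough to close the induction. -/
theorem abs_sub_spread_le_of_le {k N : ℕ} {ρ : ℝ} (hq : 1 ≤ q) (h0 : 0 ≤ ρ)
    (hρ : ∀ n ≤ k + 2, ResBound q 2 n ρ) (hN : 1 ≤ N) (hk : 16 * N ≤ (q + 1) ^ k) (M : ℕ)
    (hM : M ≤ N) (f : List (Fin (q + 1)) → ℝ) (y : List (Fin (q + 1)))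
    (c : Fin (q + 1)) (hy : y.length = M + 1 + k) :
    |f (y ++ [c]) - spread M k c f| ≤ 5 * ρ * √N * √(energy 3 (M + 1 + k + 1) f) := by
  have : Nonempty (Fin q) := ⟨⟨0, hq⟩⟩
  have := nonempty_tails hq k
  induction M using Nat.strong_induction_on generalizing f y c with
  | _ M ih =>
  have hs : 1 ≤ √(N : ℝ) := by rw [Real.one_le_sqrt]; exact_mod_cast hN
  set B := 5 * ρ * √N with hB
  have hB0 : 0 ≤ B := by positivity
  have hD : ∀ n < M, ∀ f : List (Fin (q + 1)) → ℝ,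
      |f (List.replicate (n + 1) 0) - 𝔼 a : Fin q, f (zerosCons n a [])|
        ≤ (2 * B + ρ) * √(energy 3 (n + 1) f) := by
    -- Short words are covered by the lower degree; longer ones go to a spread in each of two
    -- sections (2B) and between the spreads (ρ).
    intro n hn f
    have key : ∀ b : Fin q, |f (List.replicate (n + 1) 0) - f (zerosCons n b [])|
        ≤ (2 * B + ρ) * √(energy 3 (n + 1) f) := by
      intro b
      by_cases hnk : n + 1 ≤ k + 2
      · exact (hρ _ hnk).mono (by norm_num) (by linarith) (by linarith) f _ _ (by simp) (by simp)
      · obtain ⟨P, rfl⟩ : ∃ P, n = P + 1 + k + 1 := ⟨n - k - 2, by omega⟩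
        have hz : (List.replicate (P + 1 + k + 1) 0 : List (Fin (q + 1)))
            = List.replicate (P + 1 + k) 0 ++ [0] := List.replicate_succ'
        have e : ∀ x : Fin (q + 1), (List.replicate (P + 1 + k) 0 ++ [0] ++ [x]
            : List (Fin (q + 1))) = List.replicate (P + 1 + k + 1) 0 ++ [x] := fun x => by rw [hz]
        have h1 : ∀ x : Fin (q + 1), |f (List.replicate (P + 1 + k + 1) 0 ++ [x])
            - spread P k 0 (fun u => f (u ++ [x]))| ≤ B * √(energy 3 (P + 1 + k + 1 + 1) f) := by
          intro x
          have := ih P (by omega) (by omega) (fun u => f (u ++ [x])) (List.replicate (P + 1 + k) 0)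
            0 (by simp)
          rw [e] at this
          exact this.trans (mul_le_mul_of_nonneg_left
            (Real.sqrt_le_sqrt (energy_append_le 3 _ [x] f)) hB0)
        have h2 : |spread P k 0 (fun u => f (u ++ [0])) - spread P k 0 (fun u => f (u ++ [b.succ]))|
            ≤ ρ * √(energy 3 (P + 1 + k + 1 + 1) f) := by
          simp only [spread, zerosCons_append]
          refine (abs_expect_zerosCons_sub_le hq h0 (hρ (k + 2) le_rfl) P _ _
            (fun t => by simp [length_tailWord]) (fun t => by simp [length_tailWord]) f).trans ?_
          refine mul_le_mul_of_nonneg_left (Real.sqrt_le_sqrt ?_) h0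
          refine (energy_zerosCons_le 2 P (k + 2) f).trans (le_of_eq ?_)
          congr 1
        have h3 := h1 0
        have h4 := h1 b.succ
        have e1 : (List.replicate (P + 1 + k + 1) 0 ++ [0] : List (Fin (q + 1)))
            = List.replicate (P + 1 + k + 1 + 1) 0 := List.replicate_succ'.symm
        have e2 : (List.replicate (P + 1 + k + 1) 0 ++ [b.succ] : List (Fin (q + 1)))
            = zerosCons (P + 1 + k + 1) b [] := rfl
        rw [e1] at h3
        rw [e2] at h4
        rw [abs_le] at *
        constructor <;> linarith [h3.1, h3.2, h4.1, h4.2, h2.1, h2.2]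
    have := abs_expect_sub_expect_le (ι := Unit) (g := fun _ => f (List.replicate (n + 1) 0))
      (fun _ b => key b)
    simpa using this
  refine (abs_sub_spread_le hq h0 (hρ _ le_rfl) (by positivity) M hD f y c hy).trans ?_
  have hQ := sum_energy_zerosCons_le 2 (n := M + 1 + k + 1) (N := M) (by omega) f
  set E := energy 3 (M + 1 + k + 1) f
  have hMs : √(M : ℝ) ≤ √N := Real.sqrt_le_sqrt (by exact_mod_cast hM)
  -- The factor 16 in `hk` serves to make this 1/4, and then ρ + ρ√N + (2B + ρ)/4 ≤ 4.75ρ√N < B when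
  -- ρ > 0.
  have h4 : √(M : ℝ) / √((q + 1 : ℝ) ^ k) ≤ 1 / 4 := by
    have hp : 0 < √((q + 1 : ℝ) ^ k) := Real.sqrt_pos.2 (by positivity)
    rw [div_le_iff₀ hp]
    have : (4 : ℝ) = √16 := by
      rw [show (16 : ℝ) = 4 ^ 2 by norm_num, Real.sqrt_sq (by norm_num)]
    have h5 : 4 * √(M : ℝ) ≤ √((q + 1 : ℝ) ^ k) := by
      rw [this, ← Real.sqrt_mul (by norm_num)]
      apply Real.sqrt_le_sqrt
      have h6 : 16 * M ≤ (q + 1) ^ k := by omega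
      exact_mod_cast h6
    linarith
  have hE : 0 ≤ √E := Real.sqrt_nonneg _
  calc _ ≤ ρ * √E + ρ * (√N * √E) + (2 * B + ρ) * (1 / 4) * √E := by
        refine add_le_add (add_le_add le_rfl ?_) ?_
        · exact mul_le_mul_of_nonneg_left (mul_le_mul hMs (Real.sqrt_le_sqrt hQ)
            (Real.sqrt_nonneg _) (Real.sqrt_nonneg _)) h0
        · calc _ = (2 * B + ρ) * (√(M : ℝ) / √((q + 1 : ℝ) ^ k)) * √E := by ring
            _ ≤ _ := by gcongr
    _ = (ρ + ρ * √N + (2 * B + ρ) * (1 / 4)) * √E := by ring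
    _ ≤ B * √E := by
        gcongr
        rw [hB]
        nlinarith

theorem resBound_three {k n : ℕ} {ρ : ℝ} (hq : 1 ≤ q) (h0 : 0 ≤ ρ)
    (hρ : ∀ n ≤ k + 2, ResBound q 2 n ρ) (hn : 1 ≤ n) (hk : 16 * n ≤ (q + 1) ^ k) :
    ResBound q 3 n (11 * ρ * √n) := by
  have hs : 1 ≤ √(n : ℝ) := by rw [Real.one_le_sqrt]; exact_mod_cast hn
  have := nonempty_tails hq k
  by_cases hnk : n ≤ k + 2
  · exact (hρ _ hnk).mono (by norm_num) (by nlinarith) (by positivity)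
  · obtain ⟨M, hM⟩ : ∃ M, n = M + 1 + k + 1 := ⟨n - k - 2, by omega⟩
    intro f x y hx hy
    obtain ⟨x, c, rfl⟩ : ∃ z c', x = z ++ [c'] :=
      ⟨x.dropLast, x.getLast (by rintro rfl; simp at hx; omega),
        (List.dropLast_append_getLast _).symm⟩
    obtain ⟨y, c', rfl⟩ : ∃ z c', y = z ++ [c'] :=
      ⟨y.dropLast, y.getLast (by rintro rfl; simp at hy; omega),
        (List.dropLast_append_getLast _).symm⟩
    have h1 := abs_sub_spread_le_of_le hq h0 hρ hn hk M (by omega) f x c (by simp at hx; omega)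
    have h2 := abs_sub_spread_le_of_le hq h0 hρ hn hk M (by omega) f y c' (by simp at hy; omega)
    have h3 : |spread M k c f - spread M k c' f| ≤ ρ * √(energy 3 (M + 1 + k + 1) f) := by
      refine (abs_expect_zerosCons_sub_le hq h0 (hρ (k + 1) (by omega)) M _ _
        (fun t => length_tailWord c t) (fun t => length_tailWord c' t) f).trans ?_
      refine mul_le_mul_of_nonneg_left (Real.sqrt_le_sqrt ?_) h0
      refine (energy_zerosCons_le 2 M (k + 1) f).trans (le_of_eq ?_)
      congr 1
    rw [← hM] at h1 h2 h3
    have h4 : ρ * √(energy 3 n f) ≤ ρ * √n * √(energy 3 n f) := by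
      refine mul_le_mul_of_nonneg_right ?_ (Real.sqrt_nonneg _)
      nlinarith
    rw [abs_le] at *
    constructor <;> linarith [h1.1, h1.2, h2.1, h2.2, h3.1, h3.2]

theorem growth_eq_rpow (hq : 1 ≤ q) :
    growth q = (q + 1 : ℝ) ^ (1 - Real.logb (q + 1 : ℝ) q) := by
  have h1 : (0 : ℝ) < q := by exact_mod_cast hq
  rw [Real.rpow_sub (by positivity), Real.rpow_one,
    Real.rpow_logb (by positivity) (by linarith) h1, growth]
  field_simp

theorem logb_nonneg_and_lt_one (hq : 1 ≤ q) :
    0 ≤ Real.logb (q + 1 : ℝ) q ∧ Real.logb (q + 1 : ℝ) q < 1 := by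
  have h1 : (1 : ℝ) ≤ q := by exact_mod_cast hq
  refine ⟨Real.logb_nonneg (by linarith) h1, ?_⟩
  rw [Real.logb_lt_iff_lt_rpow (by linarith) (by linarith)]
  simp

theorem exists_resBound_three (hq : 1 ≤ q) :
    ∃ A : ℝ, 0 < A ∧ ∀ n : ℕ, 1 ≤ n →
      ResBound q 3 n (A * (n : ℝ) ^ ((2 - Real.logb (q + 1 : ℝ) q) / 2)) := by
  obtain ⟨A, hA, h⟩ := exists_resBound_two hq
  set L := Real.logb (q + 1 : ℝ) q with hL
  have hL1 : 0 < 1 - L := by linarith [(logb_nonneg_and_lt_one hq).2]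
  refine ⟨11 * (A * ((16 * (q + 1) ^ 3 : ℝ) ^ ((1 - L) / 2))), by positivity, fun n hn => ?_⟩
  have hμ := (one_lt_sqrt_growth hq).le
  have hb : 1 < q + 1 := by omega
  -- The least admissible k: then (q + 1)ᵏ is of order n, so the degree-0 bound at length k + 2 is a
  -- power of n, with exponent read off from `growth_eq_rpow`.
  set k := Nat.clog (q + 1) (16 * n) with hk_def
  have hk : 16 * n ≤ (q + 1) ^ k := Nat.le_pow_clog hb _
  have hk2 : (q + 1) ^ (k + 2) ≤ 16 * (q + 1) ^ 3 * n := by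
    have h1 : (q + 1) ^ k.pred < 16 * n := Nat.pow_pred_clog_lt_self hb (by omega)
    have hkpos : 0 < k := Nat.clog_pos hb (by omega)
    obtain ⟨k', hk'⟩ : ∃ k', k = k' + 1 := ⟨k - 1, by omega⟩
    rw [hk'] at h1 ⊢
    simp only [Nat.pred_succ] at h1
    calc (q + 1) ^ (k' + 1 + 2) = (q + 1) ^ k' * (q + 1) ^ 3 := by ring
      _ ≤ 16 * n * (q + 1) ^ 3 := by gcongr
      _ = _ := by ring
  have hρ0 : 0 ≤ A * √(growth q) ^ (k + 2) := by positivity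
  have hρ : ∀ j ≤ k + 2, ResBound q 2 j (A * √(growth q) ^ (k + 2)) := fun j hj =>
    (h j).mono le_rfl (by gcongr) hρ0
  have hpow : √(growth q) ^ (k + 2)
      ≤ (16 * (q + 1) ^ 3 : ℝ) ^ ((1 - L) / 2) * (n : ℝ) ^ ((1 - L) / 2) := by
    have hq0 : (0 : ℝ) < q + 1 := by positivity
    calc √(growth q) ^ (k + 2) = (((q + 1 : ℝ) ^ (k + 2)) ^ ((1 - L) / 2)) := by
          rw [growth_eq_rpow hq, Real.sqrt_eq_rpow, ← Real.rpow_mul hq0.le, ← Real.rpow_natCast,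
            ← Real.rpow_natCast, ← Real.rpow_mul hq0.le, ← Real.rpow_mul hq0.le]
          congr 1
          ring
      _ ≤ (16 * (q + 1) ^ 3 * n : ℝ) ^ ((1 - L) / 2) := by
          apply Real.rpow_le_rpow (by positivity) _ (by linarith)
          exact_mod_cast hk2
      _ = _ := Real.mul_rpow (by positivity) (by positivity)
  refine (resBound_three hq hρ0 hρ hn hk).mono le_rfl ?_ (by positivity)
  have hn0 : (0 : ℝ) < n := by exact_mod_cast hn
  have e : (n : ℝ) ^ ((2 - L) / 2) = (n : ℝ) ^ ((1 - L) / 2) * √n := by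
    rw [Real.sqrt_eq_rpow, ← Real.rpow_add hn0]
    congr 1
    ring
  rw [e]
  calc 11 * (A * √(growth q) ^ (k + 2)) * √n
      ≤ 11 * (A * ((16 * (q + 1) ^ 3 : ℝ) ^ ((1 - L) / 2) * (n : ℝ) ^ ((1 - L) / 2))) * √n := by
        gcongr
    _ = _ := by ring


/-! ### Raising the degree by scale doubling -/

/-- The average of `f` over the words `0ⁱ a 0ʲ` of length `l + h` with `l ≤ i` and `a ≠ 0`. -/
noncomputable def layer (l h : ℕ) (f : List (Fin (q + 1)) → ℝ) : ℝ :=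
  𝔼 p : Fin h × Fin q, f (zerosCons (l + p.1) p.2 (List.replicate (h - 1 - p.1) 0))

theorem sum_zerosCons_replicate_le (h : ℕ) {F : List (Fin (q + 1)) → ℝ} (hF : ∀ w, 0 ≤ F w) :
    ∑ p : Fin h × Fin q, F (zerosCons p.1 p.2 (List.replicate (h - 1 - p.1) 0))
      ≤ ∑ w : List.Vector (Fin (q + 1)) h, F w.1 := by
  rw [Fintype.sum_prod_type]
  induction h generalizing F with
  | zero =>
    rw [Fintype.sum_empty]
    exact Finset.sum_nonneg fun _ _ => hF _
  | succ h ih =>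
    rw [sum_vector_cons, Fin.sum_univ_succ, Fin.sum_univ_succ (n := q), add_comm]
    refine add_le_add ?_ (Finset.sum_le_sum fun a _ => ?_)
    · refine le_trans (le_of_eq ?_) (ih (F := fun w => F (0 :: w)) fun w => hF _)
      refine Finset.sum_congr rfl fun s _ => Finset.sum_congr rfl fun a _ => ?_
      congr 1
      simp only [Fin.val_succ, zerosCons, List.replicate_succ, List.cons_append]
      congr 4
      omega
    · refine le_trans (le_of_eq ?_) (Finset.single_le_sum (f := fun u : List.Vector (Fin (q + 1)) h =>
        F (a.succ :: u.1)) (fun _ _ => hF _) (Finset.mem_univ (List.Vector.replicate h 0)))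
      rfl

/-- Changing the suffix of a layer: each of the hq prefixes 0^(l+s)a leaves a word of length less
than h + L in which one degree less is available, and the energies behind them are disjoint, whence
the factor 1/√h. -/
theorem abs_expect_layer_sub_le {ι κ : Type*} [Fintype ι] [Nonempty ι] [Fintype κ] [Nonempty κ]
    {K L h : ℕ} {ρ : ℝ} (hq : 1 ≤ q) (hh : 1 ≤ h) (h0 : 0 ≤ ρ)
    (hρ : ∀ n ≤ h + L, ResBound q K n ρ) (l : ℕ)
    (u : ι → List (Fin (q + 1))) (v : κ → List (Fin (q + 1))) (hu : ∀ t, (u t).length = L)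
    (hv : ∀ t, (v t).length = L) (f : List (Fin (q + 1)) → ℝ) :
    |(𝔼 t, layer l h (fun w => f (w ++ u t))) - 𝔼 t, layer l h (fun w => f (w ++ v t))|
      ≤ ρ / √h * √(energy (K + 1) (l + h + L) f) := by
  have : Nonempty (Fin q) := ⟨⟨0, hq⟩⟩
  have : Nonempty (Fin h) := ⟨⟨0, hh⟩⟩
  have h1 : (0 : ℝ) < h := by exact_mod_cast hh
  simp only [layer, zerosCons_append]
  rw [Finset.expect_comm, Finset.expect_comm (s := (Finset.univ : Finset κ)),
    ← Finset.expect_sub_distrib]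
  refine (abs_expect_le_div_sqrt
    (e := fun p : Fin h × Fin q => energy K (l + h + L - (l + p.1 + 1))
      (fun w => f (zerosCons (l + p.1) p.2 w))) h0 (fun _ => energy_nonneg _ _ _)
    (fun p => abs_expect_sub_expect_le fun i j => ?_) ?_).trans
    (mul_le_mul_of_nonneg_right ?_ (Real.sqrt_nonneg _))
  · have hp := p.1.2
    refine hρ _ (by omega) (fun w => f (zerosCons (l + p.1) p.2 w)) _ _ ?_ ?_
    · simp [hu]; omega
    · simp [hv]; omega
  · refine le_trans (b := ∑ s ∈ Finset.range h, ∑ a : Fin q, energy K (l + h + L - (l + s + 1))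
        (fun w => f (zerosCons (l + s) a w))) (le_of_eq ?_)
      (le_trans ?_ (sum_energy_zerosCons_le K (n := l + h + L) (N := l + h) (by omega) f))
    · rw [Fintype.sum_prod_type]
      exact Fin.sum_univ_eq_sum_range (fun s => ∑ a : Fin q, energy K (l + h + L - (l + s + 1))
        (fun w => f (zerosCons (l + s) a w))) h
    · rw [Finset.sum_range_add]
      exact le_add_of_nonneg_left
        (Finset.sum_nonneg fun _ _ => Finset.sum_nonneg fun _ _ => energy_nonneg _ _ _)
  · have : (0 : ℝ) < √h := Real.sqrt_pos.2 h1
    gcongr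
    simp only [Fintype.card_prod, Fintype.card_fin]
    exact Nat.le_mul_of_pos_right _ hq

/-- Write the word as x·w. Go from x to the layer inside the section w (cost e); behind the layer's
prefixes exchange w for the average over tails 0ˢa0ᵗ (cost ρ/√h); then return from the layer to
0^(l+h) inside each tail's section, averaged over at least 2h tails (cost e/√(2h)). The words
0^(l+h)·tail form the next layer. -/
theorem abs_sub_layer_step {K l h : ℕ} {ρ e : ℝ} (hq : 1 ≤ q) (hh : 1 ≤ h) (h0 : 0 ≤ ρ)
    (hρ : ∀ n ≤ h + 2 * h, ResBound q K n ρ) (he : 0 ≤ e)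
    (H : ∀ (f : List (Fin (q + 1)) → ℝ) (x : List (Fin (q + 1))), x.length = l + h →
      |f x - layer l h f| ≤ e * √(energy (K + 1) (l + h) f))
    (f : List (Fin (q + 1)) → ℝ) (x : List (Fin (q + 1))) (hx : x.length = l + h + 2 * h) :
    |f x - layer (l + h) (2 * h) f| ≤ (e * (1 + 1 / √((2 * h : ℕ) : ℝ)) + ρ / √h)
      * √(energy (K + 1) (l + h + 2 * h) f) := by
  have : Nonempty (Fin q) := ⟨⟨0, hq⟩⟩
  have : Nonempty (Fin (2 * h)) := ⟨⟨0, by omega⟩⟩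
  obtain ⟨x, w, rfl, hx', hw⟩ : ∃ y w, x = y ++ w ∧ y.length = l + h ∧ w.length = 2 * h :=
    ⟨x.take (l + h), x.drop (l + h), (List.take_append_drop _ _).symm, by simp; omega,
      by simp; omega⟩
  set E := energy (K + 1) (l + h + 2 * h) f
  have h1 : |f (x ++ w) - layer l h (fun u => f (u ++ w))| ≤ e * √E := by
    refine (H (fun u => f (u ++ w)) x hx').trans ?_
    have := energy_append_le (K + 1) (l + h) w f
    rw [hw] at this
    gcongr
  set tl : Fin (2 * h) × Fin q → List (Fin (q + 1)) := fun p =>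
    zerosCons p.1 p.2 (List.replicate (2 * h - 1 - p.1) 0) with htl
  have htl_len : ∀ p, (tl p).length = 2 * h := fun p => by
    have := p.1.2
    simp [htl]; omega
  have h2 := abs_expect_layer_sub_le (ι := Unit) hq hh h0 hρ l (fun _ => w) tl (fun _ => hw)
    htl_len f
  rw [Finset.expect_const Finset.univ_nonempty] at h2
  have h3 : |𝔼 p, (f (List.replicate (l + h) 0 ++ tl p) - layer l h (fun u => f (u ++ tl p)))|
      ≤ e / √(Fintype.card (Fin (2 * h) × Fin q)) * √E := by
    refine abs_expect_le_div_sqrt (e := fun p => energy (K + 1) (l + h) (fun u => f (u ++ tl p)))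
      he (fun _ => energy_nonneg _ _ _) (fun p => ?_) ?_
    · exact H (fun u => f (u ++ tl p)) _ (by simp)
    · exact (sum_zerosCons_replicate_le (2 * h)
        (F := fun w => energy (K + 1) (l + h) (fun u => f (u ++ w)))
        fun _ => energy_nonneg _ _ _).trans (sum_energy_append_le (K + 1) (l + h) (2 * h) f)
  have h4 : (𝔼 p, f (List.replicate (l + h) 0 ++ tl p)) = layer (l + h) (2 * h) f := by
    unfold layer
    refine Finset.expect_congr rfl fun p _ => ?_
    congr 1
    simp only [htl, zerosCons]
    rw [← List.append_assoc, List.replicate_append_replicate]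
  rw [Finset.expect_sub_distrib, h4] at h3
  have h5 : e / √(Fintype.card (Fin (2 * h) × Fin q)) ≤ e * (1 / √((2 * h : ℕ) : ℝ)) := by
    rw [mul_one_div]
    have : (0 : ℝ) < √((2 * h : ℕ) : ℝ) := Real.sqrt_pos.2 (by exact_mod_cast (by omega))
    gcongr
    simp only [Fintype.card_prod, Fintype.card_fin]
    exact Nat.le_mul_of_pos_right _ hq
  have h6 := h3.trans (mul_le_mul_of_nonneg_right h5 (Real.sqrt_nonneg _))
  rw [abs_le] at *
  constructor <;> linarith [h1.1, h1.2, h2.1, h2.2, h6.1, h6.2]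

/-- Iterates the step with h = 2ʲ and l = 2ʲ - 1, which reproduces this shape. The exponential
bounds the product of the factors 1 + 2^(-i/2). -/
theorem abs_sub_layer_le {K : ℕ} {σ : ℕ → ℝ} (hq : 1 ≤ q) (hσ : ∀ i, 0 ≤ σ i)
    (hρ : ∀ i, ∀ n ≤ 4 * 2 ^ i, ResBound q K n (σ i * √(2 ^ i))) (j : ℕ)
    (f : List (Fin (q + 1)) → ℝ) (x : List (Fin (q + 1))) (hx : x.length = 2 ^ j - 1 + 2 ^ j) :
    |f x - layer (2 ^ j - 1) (2 ^ j) f|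
      ≤ Real.exp (4 - 4 * (1 / √2) ^ j) * (1 + ∑ i ∈ Finset.range j, σ i)
        * √(energy (K + 1) (2 ^ j - 1 + 2 ^ j) f) := by
  induction j generalizing f x with
  | zero =>
    have : Nonempty (Fin q) := ⟨⟨0, hq⟩⟩
    obtain ⟨c, rfl⟩ := List.length_eq_one_iff.1 (show x.length = 1 by simpa using hx)
    have := abs_expect_sub_expect_le (ι := Unit) (κ := Fin 1 × Fin q) (g := fun _ => f [c])
      (h := fun p => f [p.2.succ]) (fun _ b =>
      abs_sub_cons_le (K := K + 1) (n := 0) (by omega) (u := []) rfl c b.2.succ f)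
    simpa [layer, zerosCons] using this
  | succ j ih =>
    have hp : 1 ≤ 2 ^ j := Nat.one_le_two_pow
    have e1 : 2 ^ (j + 1) = 2 * 2 ^ j := by ring
    have e2 : 2 ^ (j + 1) - 1 = 2 ^ j - 1 + 2 ^ j := by omega
    rw [e2, e1] at hx ⊢
    have hS : 0 ≤ ∑ i ∈ Finset.range j, σ i := Finset.sum_nonneg fun i _ => hσ i
    have step := abs_sub_layer_step hq hp (mul_nonneg (hσ j) (Real.sqrt_nonneg _))
      (fun n hn => hρ j n (by omega)) (by positivity) ih f x hx
    refine step.trans (mul_le_mul_of_nonneg_right ?_ (Real.sqrt_nonneg _))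
    have hr0 : 0 < 1 / √(2 : ℝ) := by positivity
    have hr1 : 1 / √(2 : ℝ) ≤ 4 / 5 := by
      rw [div_le_iff₀ (by positivity)]
      have : (5 / 4 : ℝ) ≤ √2 := Real.le_sqrt_of_sq_le (by norm_num)
      linarith
    have e3 : 1 / √((2 * 2 ^ j : ℕ) : ℝ) = (1 / √2) ^ (j + 1) := by
      rw [← e1, Nat.cast_pow, Nat.cast_ofNat, one_div_pow]
      congr 1
      have h2 : (√2 : ℝ) ^ 2 = 2 := Real.sq_sqrt (by norm_num)
      conv_lhs => rw [← h2]
      rw [← pow_mul, mul_comm, pow_mul, Real.sqrt_sq (by positivity)]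
    rw [e3]
    generalize 1 / √(2 : ℝ) = r at hr0 hr1
    have e4 : σ j * √(2 ^ j) / √((2 ^ j : ℕ) : ℝ) = σ j := by
      rw [Nat.cast_pow, Nat.cast_ofNat, mul_div_assoc, div_self, mul_one]
      positivity
    rw [e4, Finset.sum_range_succ]
    have hrj : 0 < r ^ j := by positivity
    -- This is 5r ≤ 4, the reason for the coefficient 4 in the exponent.
    have hr1' : r ^ (j + 1) ≤ 4 * r ^ j - 4 * r ^ (j + 1) := by
      rw [pow_succ]; nlinarith
    have hexp : Real.exp (4 - 4 * r ^ j) * (1 + r ^ (j + 1)) ≤ Real.exp (4 - 4 * r ^ (j + 1)) := by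
      calc _ ≤ Real.exp (4 - 4 * r ^ j) * Real.exp (r ^ (j + 1)) := by
            gcongr
            linarith [Real.add_one_le_exp (r ^ (j + 1))]
        _ = Real.exp (4 - 4 * r ^ j + r ^ (j + 1)) := by rw [Real.exp_add]
        _ ≤ _ := Real.exp_le_exp.2 (by linarith)
    have hone : 1 ≤ Real.exp (4 - 4 * r ^ (j + 1)) := by
      apply Real.one_le_exp
      have : r ^ (j + 1) ≤ 1 := pow_le_one₀ hr0.le (by linarith)
      linarith
    calc _ = Real.exp (4 - 4 * r ^ j) * (1 + r ^ (j + 1)) * (1 + ∑ i ∈ Finset.range j, σ i)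
          + 1 * σ j := by ring
      _ ≤ Real.exp (4 - 4 * r ^ (j + 1)) * (1 + ∑ i ∈ Finset.range j, σ i)
          + Real.exp (4 - 4 * r ^ (j + 1)) * σ j := by
        have := hσ j
        gcongr
      _ = _ := by ring

/-- Both endpoints are led to the layer of scale 2ʲ inside the sections of their own suffixes;
exchanging the suffix there costs only the extra term σⱼ. -/
theorem resBound_succ {K : ℕ} {σ : ℕ → ℝ} (hq : 1 ≤ q) (hσ : ∀ i, 0 ≤ σ i)
    (hρ : ∀ i, ∀ n ≤ 4 * 2 ^ i, ResBound q K n (σ i * √(2 ^ i))) {j n : ℕ}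
    (hn : 2 ^ (j + 1) ≤ n + 1) (hn' : n ≤ 4 * 2 ^ j) :
    ResBound q (K + 1) n (2 * Real.exp 4 * (1 + ∑ i ∈ Finset.range (j + 1), σ i)) := by
  intro f x y hx hy
  have hp : 1 ≤ 2 ^ j := Nat.one_le_two_pow
  have e1 : 2 ^ (j + 1) = 2 * 2 ^ j := by ring
  obtain ⟨L, hL⟩ : ∃ L, n = 2 ^ j - 1 + 2 ^ j + L := ⟨n - (2 ^ j - 1 + 2 ^ j), by omega⟩
  have hS : 0 ≤ ∑ i ∈ Finset.range j, σ i := Finset.sum_nonneg fun i _ => hσ i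
  have key : ∀ z : List (Fin (q + 1)), z.length = n → ∃ w : List (Fin (q + 1)), w.length = L ∧
      |f z - layer (2 ^ j - 1) (2 ^ j) (fun u => f (u ++ w))|
        ≤ Real.exp 4 * (1 + ∑ i ∈ Finset.range j, σ i) * √(energy (K + 1) n f) := by
    intro z hz
    refine ⟨z.drop (2 ^ j - 1 + 2 ^ j), by simp; omega, ?_⟩
    have h1 := abs_sub_layer_le hq hσ hρ j
      (fun u => f (u ++ z.drop (2 ^ j - 1 + 2 ^ j))) (z.take (2 ^ j - 1 + 2 ^ j))
      (by simp; omega)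
    rw [List.take_append_drop] at h1
    refine h1.trans (mul_le_mul ?_ (Real.sqrt_le_sqrt ?_) (Real.sqrt_nonneg _) (by positivity))
    · gcongr
      have : 0 ≤ (1 / √(2 : ℝ)) ^ j := by positivity
      linarith
    · refine (energy_append_le (K + 1) _ _ f).trans (le_of_eq ?_)
      congr 1
      simp
      omega
  obtain ⟨w, hw, h1⟩ := key x hx
  obtain ⟨w', hw', h2⟩ := key y hy
  have h3 := abs_expect_layer_sub_le (ι := Unit) (κ := Unit) (L := L) hq hp
    (mul_nonneg (hσ j) (Real.sqrt_nonneg _)) (fun n hn => hρ j n (by omega)) (2 ^ j - 1)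
    (fun _ => w) (fun _ => w') (fun _ => hw) (fun _ => hw') f
  rw [Finset.expect_const Finset.univ_nonempty, Finset.expect_const Finset.univ_nonempty,
    ← hL] at h3
  have e4 : σ j * √(2 ^ j) / √((2 ^ j : ℕ) : ℝ) = σ j := by
    rw [Nat.cast_pow, Nat.cast_ofNat, mul_div_assoc, div_self, mul_one]
    positivity
  rw [e4] at h3
  rw [Finset.sum_range_succ]
  have hexp : 1 ≤ Real.exp 4 := Real.one_le_exp (by norm_num)
  have h4 : σ j * √(energy (K + 1) n f) ≤ 2 * Real.exp 4 * σ j * √(energy (K + 1) n f) := by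
    refine mul_le_mul_of_nonneg_right ?_ (Real.sqrt_nonneg _)
    nlinarith [hσ j]
  rw [abs_le] at *
  constructor <;> linarith [h1.1, h1.2, h2.1, h2.2, h3.1, h3.2]

theorem resBound_zero (q K : ℕ) {ρ : ℝ} (h0 : 0 ≤ ρ) : ResBound q K 0 ρ := by
  intro f x y hx hy
  rw [List.length_eq_zero_iff] at hx hy
  subst hx hy
  simp
  positivity

theorem exists_two_pow_le (n : ℕ) (hn : 1 ≤ n) : ∃ j, 2 ^ (j + 1) ≤ n + 1 ∧ n ≤ 4 * 2 ^ j := by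
  have h1 : Nat.log 2 (n + 1) ≠ 0 := (Nat.log_pos one_lt_two (by omega)).ne'
  have h2 := Nat.pow_log_le_self 2 (x := n + 1) (by omega)
  have h3 := Nat.lt_pow_succ_log_self one_lt_two (n + 1)
  obtain ⟨j, hj⟩ : ∃ j, Nat.log 2 (n + 1) = j + 1 := ⟨_, (Nat.succ_pred h1).symm⟩
  rw [hj] at h2 h3
  refine ⟨j, h2, ?_⟩
  have : 2 ^ (j + 1).succ = 4 * 2 ^ j := by rw [Nat.succ_eq_add_one]; ring
  omega

/-- With ρ(n) of order n^α the scale costs σᵢ are geometric with ratio 2^(α-1/2); the three cases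
that follow sum this series. -/
theorem exists_resBound_succ_of_rpow {K : ℕ} {α C : ℝ} (hq : 1 ≤ q) (hα : 0 ≤ α) (hC : 0 ≤ C)
    (h : ∀ n : ℕ, 1 ≤ n → ResBound q K n (C * (n : ℝ) ^ α)) :
    ∃ D : ℝ, 0 ≤ D ∧ ∀ n : ℕ, 1 ≤ n → ∃ j : ℕ, 2 ^ (j + 1) ≤ n + 1 ∧
      ResBound q (K + 1) n (2 * Real.exp 4 * (1 + D * ∑ i ∈ Finset.range (j + 1),
        ((2 : ℝ) ^ (α - 1 / 2)) ^ i)) := by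
  refine ⟨C * 4 ^ α, by positivity, fun n hn => ?_⟩
  obtain ⟨j, hj, hj'⟩ := exists_two_pow_le n hn
  refine ⟨j, hj, ?_⟩
  rw [Finset.mul_sum]
  refine resBound_succ hq (fun i => by positivity) (fun i n hn => ?_) hj hj'
  rcases Nat.eq_zero_or_pos n with rfl | hn0
  · exact resBound_zero q K (by positivity)
  · refine (h n hn0).mono le_rfl ?_ (by positivity)
    have e : ((2 : ℝ) ^ (α - 1 / 2)) ^ i * √(2 ^ i) = (2 ^ i) ^ α := by
      rw [Real.sqrt_eq_rpow, ← Real.rpow_natCast 2 i, ← Real.rpow_natCast, ← Real.rpow_mul (by norm_num),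
        ← Real.rpow_mul (by norm_num), ← Real.rpow_mul (by norm_num),
        ← Real.rpow_add (by norm_num)]
      congr 1
      ring
    rw [mul_assoc, e, mul_assoc, ← Real.mul_rpow (by norm_num) (by positivity)]
    gcongr
    exact_mod_cast hn

theorem exists_resBound_succ_of_half_lt {K : ℕ} {α C : ℝ} (hq : 1 ≤ q) (hα : 1 / 2 < α)
    (hC : 0 ≤ C) (h : ∀ n : ℕ, 1 ≤ n → ResBound q K n (C * (n : ℝ) ^ α)) :
    ∃ D : ℝ, 0 < D ∧ ∀ n : ℕ, 1 ≤ n → ResBound q (K + 1) n (D * (n : ℝ) ^ (α - 1 / 2)) := by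
  obtain ⟨D, hD, H⟩ := exists_resBound_succ_of_rpow hq (by linarith) hC h
  set β := α - 1 / 2 with hβ
  have hβ0 : 0 < β := by linarith
  have hg : 1 < (2 : ℝ) ^ β := Real.one_lt_rpow one_lt_two hβ0
  have hg' : 0 < (2 : ℝ) ^ β - 1 := by linarith
  refine ⟨2 * Real.exp 4 * (1 + D * (2 ^ β / (2 ^ β - 1))), by positivity, fun n hn => ?_⟩
  obtain ⟨j, hj, hR⟩ := H n hn
  have hn1 : (1 : ℝ) ≤ n := by exact_mod_cast hn
  have hnβ : 1 ≤ (n : ℝ) ^ β := Real.one_le_rpow hn1 hβ0.le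
  refine hR.mono le_rfl ?_ (by positivity)
  have hsum : ∑ i ∈ Finset.range (j + 1), ((2 : ℝ) ^ β) ^ i ≤ 2 ^ β / (2 ^ β - 1) * (n : ℝ) ^ β := by
    rw [geom_sum_eq hg.ne', div_mul_eq_mul_div, ← Real.mul_rpow (by norm_num) (by positivity)]
    gcongr
    have : ((2 : ℝ) ^ β) ^ (j + 1) ≤ (2 * n) ^ β := by
      rw [← Real.rpow_natCast, ← Real.rpow_mul (by norm_num), mul_comm, Real.rpow_mul (by norm_num),
        Real.rpow_natCast]
      apply Real.rpow_le_rpow (by positivity) _ hβ0.le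
      have : 2 ^ (j + 1) ≤ 2 * n := by omega
      exact_mod_cast this
    linarith
  calc _ ≤ 2 * Real.exp 4 * (1 * (n : ℝ) ^ β + D * (2 ^ β / (2 ^ β - 1) * (n : ℝ) ^ β)) := by
        gcongr
        linarith
    _ = _ := by ring

theorem exists_resBound_succ_of_lt_half {K : ℕ} {α C : ℝ} (hq : 1 ≤ q) (hα0 : 0 ≤ α)
    (hα : α < 1 / 2) (hC : 0 ≤ C) (h : ∀ n : ℕ, 1 ≤ n → ResBound q K n (C * (n : ℝ) ^ α)) :
    ∃ D : ℝ, 0 < D ∧ ∀ n : ℕ, 1 ≤ n → ResBound q (K + 1) n D := by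
  obtain ⟨D, hD, H⟩ := exists_resBound_succ_of_rpow hq hα0 hC h
  set β := α - 1 / 2 with hβ
  have hg : (2 : ℝ) ^ β < 1 := Real.rpow_lt_one_of_one_lt_of_neg one_lt_two (by linarith)
  have hg0 : 0 < (2 : ℝ) ^ β := by positivity
  have hg' : 0 < 1 - (2 : ℝ) ^ β := by linarith
  refine ⟨2 * Real.exp 4 * (1 + D * (1 / (1 - 2 ^ β))), by positivity, fun n hn => ?_⟩
  obtain ⟨j, hj, hR⟩ := H n hn
  refine hR.mono le_rfl ?_ (by positivity)
  gcongr
  rw [geom_sum_eq hg.ne, ← neg_div_neg_eq, neg_sub, neg_sub]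
  gcongr
  have : 0 ≤ ((2 : ℝ) ^ β) ^ (j + 1) := by positivity
  linarith

theorem exists_resBound_succ_of_eq_half {K : ℕ} {C : ℝ} (hq : 1 ≤ q) (hC : 0 ≤ C)
    (h : ∀ n : ℕ, 1 ≤ n → ResBound q K n (C * (n : ℝ) ^ (1 / 2 : ℝ))) :
    ∃ D : ℝ, 0 < D ∧ ∀ n : ℕ, 2 ≤ n → ResBound q (K + 1) n (D * Real.log n) := by
  obtain ⟨D, hD, H⟩ := exists_resBound_succ_of_rpow hq (by norm_num) hC h
  have hl2 : 0 < Real.log 2 := Real.log_pos one_lt_two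
  refine ⟨2 * Real.exp 4 * (1 / Real.log 2 + D * (2 / Real.log 2)), by positivity, fun n hn => ?_⟩
  obtain ⟨j, hj, hR⟩ := H n (by omega)
  have hn2 : (2 : ℝ) ≤ n := by exact_mod_cast hn
  have hln : Real.log 2 ≤ Real.log n := Real.log_le_log (by norm_num) hn2
  have hln0 : 0 < Real.log n := hl2.trans_le hln
  refine hR.mono le_rfl ?_ (by positivity)
  have h1 : 1 ≤ 1 / Real.log 2 * Real.log n := by
    rw [one_div_mul_eq_div, le_div_iff₀ hl2]; linarith
  have h2 : ∑ i ∈ Finset.range (j + 1), ((2 : ℝ) ^ ((1 / 2 : ℝ) - 1 / 2)) ^ i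
      ≤ 2 / Real.log 2 * Real.log n := by
    simp only [sub_self, Real.rpow_zero, one_pow, Finset.sum_const, Finset.card_range,
      nsmul_eq_mul, mul_one]
    rw [div_mul_eq_mul_div, le_div_iff₀ hl2, ← Real.log_pow]
    have e : (2 : ℝ) * Real.log n = Real.log ((n : ℝ) ^ 2) := by rw [Real.log_pow]; norm_num
    rw [e]
    apply Real.log_le_log (by positivity)
    have : 2 ^ (j + 1) ≤ n ^ 2 := by nlinarith
    exact_mod_cast this
  calc _ ≤ 2 * Real.exp 4 * (1 / Real.log 2 * Real.log n + D * (2 / Real.log 2 * Real.log n)) := by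
        gcongr
    _ = _ := by ring


/-! ### The level groups are finite -/

namespace TwoLevel

variable {m : ℕ}

@[ext] theorem ext' {s t : TwoLevel m} (h1 : s.top = t.top) (h2 : s.below = t.below) : s = t := by
  cases s; cases t; simp_all

/-- The identity automorphism of the first two levels. -/
def one (m : ℕ) : TwoLevel m := ⟨1, fun _ => 1, fun _ _ => rfl⟩

/-- The composition of automorphisms of the first two levels. -/
def mul (s t : TwoLevel m) : TwoLevel m where
  top := s.top * t.top
  below x := s.below (t.top x) * t.below x
  top_zero x hx := by simp [t.top_zero x hx, s.top_zero x hx]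

theorem inv_mul (s : TwoLevel m) : s.inv.mul s = one m := by
  ext x
  · simp [mul, inv, one]
  · simp [mul, inv, one]

instance : Finite (TwoLevel m) :=
  Finite.of_injective (fun s : TwoLevel m => (s.top, s.below)) fun s t h => by
    simp only [Prod.mk.injEq] at h
    exact ext' h.1 h.2

end TwoLevel

/-- Apply to the `(k+1)`st nonzero letter and its successor the element of `Sym(m) ≀ Sym(m-1)` that
`S` assigns to the word formed by the first `k` nonzero letters. -/
def lamAll {m : ℕ} : ℕ → (List (Fin m) → TwoLevel m) → List (Fin m) → List (Fin m)
  | _, _, [] => []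
  | 0, S, x :: u =>
      if x.val = 0 then x :: lamAll 0 S u else (S []).top x :: headMap ((S []).below x) u
  | k + 1, S, x :: u =>
      if x.val = 0 then x :: lamAll (k + 1) S u else x :: lamAll k (fun w => S (x :: w)) u

section lamAll

variable {m : ℕ}

theorem lamAll_one (k : ℕ) (u : List (Fin m)) : lamAll k (fun _ => TwoLevel.one m) u = u := by
  induction u generalizing k with
  | nil => simp [lamAll]
  | cons x u ih =>
    cases k with
    | zero =>
      by_cases hx : x.val = 0
      · simp [lamAll, hx, ih]
      · cases u <;> simp [lamAll, hx, TwoLevel.one, headMap]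
    | succ k => by_cases hx : x.val = 0 <;> simp [lamAll, hx, ih]

/-- The map changes neither the positions of the zeros up to the (k+1)st nonzero letter nor the
first k nonzero letters, so the selected element of the wreath product is the same for both factors.
-/
theorem lamAll_lamAll (k : ℕ) (S T : List (Fin m) → TwoLevel m) (u : List (Fin m)) :
    lamAll k S (lamAll k T u) = lamAll k (fun w => (S w).mul (T w)) u := by
  induction u generalizing k S T with
  | nil => simp [lamAll]
  | cons x u ih =>
    cases k with
    | zero =>
      by_cases hx : x.val = 0
      · simp [lamAll, hx, ih]
      · have h := (T []).top_ne_zero x hx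
        cases u <;> simp [lamAll, hx, h, TwoLevel.mul, headMap]
    | succ k => by_cases hx : x.val = 0 <;> simp [lamAll, hx, ih]

theorem lamAll_congr (k : ℕ) {S T : List (Fin m) → TwoLevel m}
    (h : ∀ w, w.length = k → S w = T w) (u : List (Fin m)) : lamAll k S u = lamAll k T u := by
  induction u generalizing k S T with
  | nil => simp [lamAll]
  | cons x u ih =>
    cases k with
    | zero =>
      by_cases hx : x.val = 0
      · simp only [lamAll, hx, if_true, ih 0 h]
      · simp only [lamAll, hx, if_false, h [] rfl]
    | succ k =>
      by_cases hx : x.val = 0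
      · simp only [lamAll, hx, if_true, ih (k + 1) h]
      · simp only [lamAll, hx, if_false]
        rw [ih k (S := fun w => S (x :: w)) (T := fun w => T (x :: w)) fun w hw => h _ (by simp [hw])]

theorem lamMap_eq_lamAll (s : TwoLevel m) (w u : List (Fin m)) :
    lamMap s w u = lamAll w.length (fun v => if v = w then s else TwoLevel.one m) u := by
  induction u generalizing w with
  | nil => simp [lamMap, lamAll]
  | cons x u ih =>
    cases w with
    | nil =>
      by_cases hx : x.val = 0
      · simp [lamMap, lamAll, hx, ih]
      · simp [lamMap, lamAll, hx]
    | cons a w =>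
      by_cases hx : x.val = 0
      · simp [lamMap, lamAll, hx, ih]
      · by_cases ha : x = a
        · subst ha
          simp [lamMap, lamAll, hx, ih]
        · simp [lamMap, lamAll, hx, ha, lamAll_one]

theorem exists_eq_lamAll (k : ℕ) {g : Equiv.Perm (List (Fin m))} (hg : g ∈ levelGroup m (k + 1)) :
    ∃ S, ⇑g = lamAll k S := by
  induction hg using Subgroup.closure_induction with
  | mem g hg =>
    obtain ⟨w, s, rfl, -, rfl⟩ := hg
    exact ⟨_, funext fun u => lamMap_eq_lamAll s w u⟩
  | one => exact ⟨fun _ => TwoLevel.one m, funext fun u => (lamAll_one k u).symm⟩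
  | mul g h _ _ hg hh =>
    obtain ⟨S, hS⟩ := hg
    obtain ⟨T, hT⟩ := hh
    refine ⟨fun w => (S w).mul (T w), funext fun u => ?_⟩
    rw [Equiv.Perm.mul_apply, hS, hT, lamAll_lamAll]
  | inv g _ hg =>
    obtain ⟨S, hS⟩ := hg
    refine ⟨fun w => (S w).inv, funext fun u => ?_⟩
    obtain ⟨v, rfl⟩ := g.surjective u
    change g.symm (g v) = _
    rw [Equiv.symm_apply_apply, hS, lamAll_lamAll]
    simp_rw [TwoLevel.inv_mul]
    exact (lamAll_one k v).symm

theorem exists_eq_headPerm {g : Equiv.Perm (List (Fin m))} (hg : g ∈ levelGroup m 0) :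
    ∃ σ, g = headPerm σ := by
  induction hg using Subgroup.closure_induction with
  | mem g hg => exact hg
  | one => exact ⟨1, Equiv.ext fun u => by cases u <;> rfl⟩
  | mul g h _ _ hg hh =>
    obtain ⟨S, rfl⟩ := hg
    obtain ⟨T, rfl⟩ := hh
    exact ⟨S * T, Equiv.ext fun u => by cases u <;> rfl⟩
  | inv g _ hg =>
    obtain ⟨S, rfl⟩ := hg
    exact ⟨S⁻¹, Equiv.ext fun u => by cases u <;> rfl⟩

/-- An element is determined by the values of `S` on the finitely many words of length k. Finiteness
matters because `Nat.card` of an infinite set of edges would be 0. -/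
instance finite_levelGroup (j : ℕ) : Finite (levelGroup m j) := by
  cases j with
  | zero =>
    choose σ hσ using fun g : levelGroup m 0 => exists_eq_headPerm g.2
    refine Finite.of_injective σ fun g h hgh => Subtype.ext ?_
    rw [hσ g, hσ h, hgh]
  | succ k =>
    choose S hS using fun g : levelGroup m (k + 1) => exists_eq_lamAll k g.2
    refine Finite.of_injective
      (fun g => fun w : List.Vector (Fin m) k => S g w.1) fun g h hgh => Subtype.ext ?_
    refine Equiv.coe_fn_injective ?_
    change ⇑g.1 = ⇑h.1
    rw [hS g, hS h]
    exact funext fun u => lamAll_congr k (fun w hw => congrFun hgh ⟨w, hw⟩) u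

end lamAll

/-! ### Moves are edges of the mother graph -/

theorem Move.exists_lamMap {q j : ℕ} {x y : List (Fin (q + 1))} (h : Move (j + 1) x y) :
    ∃ (w : List (Fin (q + 1))) (s : TwoLevel (q + 1)), w.length = j ∧ (∀ a ∈ w, a.val ≠ 0) ∧
      lamMap s w x = y := by
  generalize hk : j + 1 = k at h
  induction h generalizing j with
  | head => omega
  | zero _ ih =>
    obtain ⟨w, s, h1, h2, h3⟩ := ih hk
    refine ⟨w, s, h1, h2, ?_⟩
    cases w <;> simp [lamMap, h3]
  | @succ i u v a hm ih =>
    obtain rfl : j = i := by omega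
    cases j with
    | zero =>
      cases hm with
      | head x y u =>
        -- Fix all nonzero letters and swap x and y below each of them.
        refine ⟨[], ⟨1, fun _ => Equiv.swap x y, fun _ _ => rfl⟩, rfl, by simp, ?_⟩
        simp [lamMap, headMap]
    | succ j =>
      obtain ⟨w, s, h1, h2, h3⟩ := ih rfl
      refine ⟨a.succ :: w, s, by simp [h1], ?_, ?_⟩
      · intro b hb
        rcases List.mem_cons.1 hb with rfl | hb
        · simp
        · exact h2 b hb
      · simp [lamMap, h3]

theorem Move.exists_mem_levelGroup {q j : ℕ} {x y : List (Fin (q + 1))} (h : Move j x y) :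
    ∃ g ∈ levelGroup (q + 1) j, g x = y := by
  cases j with
  | zero =>
    cases h with
    | head x y u =>
      exact ⟨headPerm (Equiv.swap x y), Subgroup.subset_closure ⟨_, rfl⟩, by
        simp [headPerm, headMap]⟩
  | succ j =>
    obtain ⟨w, s, h1, h2, h3⟩ := h.exists_lamMap
    exact ⟨lam w s, Subgroup.subset_closure ⟨w, s, h1, h2, rfl⟩, h3⟩

theorem motherGraph_symm (d m n : ℕ) (x y : List.Vector (Fin m) n) :
    motherGraph d m n x y = motherGraph d m n y x := by
  unfold motherGraph
  refine Finset.sum_congr rfl fun j _ => Nat.card_congr ?_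
  refine (Equiv.inv (levelGroup m j)).subtypeEquiv fun g => ?_
  simp only [Equiv.inv_apply, InvMemClass.coe_inv]
  rw [Equiv.Perm.inv_eq_iff_eq, eq_comm]

/-- Rayleigh monotonicity: every move is realised by at least one group element, hence by an edge of
multiplicity at least 1. -/
theorem energy_le_motherGraph (d q n : ℕ) (f : List (Fin (q + 1)) → ℝ) :
    energy (d + 2) n f ≤ ∑ x, ∑ y, (motherGraph d (q + 1) n x y : ℝ) * (f x.1 - f y.1) ^ 2 := by
  classical
  unfold energy levelEnergy
  rw [Finset.sum_comm]
  refine Finset.sum_le_sum fun x _ => ?_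
  rw [Finset.sum_comm]
  refine Finset.sum_le_sum fun y _ => ?_
  rw [motherGraph, Nat.cast_sum, Finset.sum_mul]
  refine Finset.sum_le_sum fun j _ => ?_
  split_ifs with h
  · obtain ⟨g, hg, hgx⟩ := h.exists_mem_levelGroup
    have : Nonempty {g : levelGroup (q + 1) j // g.1 x.1 = y.1} := ⟨⟨⟨g, hg⟩, hgx⟩⟩
    have h1 : (1 : ℝ) ≤ Nat.card {g : levelGroup (q + 1) j // g.1 x.1 = y.1} := by
      exact_mod_cast Nat.card_pos
    exact le_mul_of_one_le_left (sq_nonneg _) h1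
  · positivity

/-! ### Resistance and the Dirichlet form -/

section network

variable {V : Type*} [Fintype V] {G : V → V → ℕ}

theorem sum_mul_laplacian (hG : ∀ x y, G x y = G y x) (f v : V → ℝ) :
    ∑ x, f x * ∑ y, (G x y : ℝ) * (v x - v y)
      = 1 / 2 * ∑ x, ∑ y, (G x y : ℝ) * ((f x - f y) * (v x - v y)) := by
  have h1 : ∑ x, ∑ y, (G x y : ℝ) * (f x * (v x - v y))
      = ∑ x, ∑ y, (G x y : ℝ) * (f y * (v y - v x)) := by
    rw [Finset.sum_comm]
    refine Finset.sum_congr rfl fun x _ => Finset.sum_congr rfl fun y _ => ?_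
    rw [hG]
  have h2 : ∑ x, f x * ∑ y, (G x y : ℝ) * (v x - v y)
      = ∑ x, ∑ y, (G x y : ℝ) * (f x * (v x - v y)) := by
    refine Finset.sum_congr rfl fun x _ => ?_
    rw [Finset.mul_sum]
    exact Finset.sum_congr rfl fun y _ => by ring
  have h3 : ∑ x, ∑ y, (G x y : ℝ) * ((f x - f y) * (v x - v y))
      = ∑ x, ∑ y, (G x y : ℝ) * (f x * (v x - v y))
        + ∑ x, ∑ y, (G x y : ℝ) * (f y * (v y - v x)) := by
    simp_rw [← Finset.sum_add_distrib]
    exact Finset.sum_congr rfl fun x _ => Finset.sum_congr rfl fun y _ => by ring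
  rw [h3, ← h1, h2]
  ring

variable [DecidableEq V]

theorem IsUnitVoltage.sum_mul_sub_eq {a b : V} {v : V → ℝ} (hv : IsUnitVoltage G a b v)
    (hG : ∀ x y, G x y = G y x) (f : V → ℝ) :
    1 / 2 * ∑ x, ∑ y, (G x y : ℝ) * ((f x - f y) * (v x - v y)) = f a - f b := by
  rw [← sum_mul_laplacian hG]
  simp_rw [hv _, mul_sub, Finset.sum_sub_distrib]
  simp

/-- Needed because the infimum defining the resistance is ∞ when no voltage exists. If δ_a - δ_b
were outside the range of the Laplacian, a functional ⟨g, ·⟩ would vanish on the range but not on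
it; then g has zero energy, and the hypothesis forces g(a) = g(b), a contradiction. -/
theorem exists_isUnitVoltage (hG : ∀ x y, G x y = G y x) {a b : V} {ρ : ℝ}
    (h : ∀ f : V → ℝ, |f a - f b| ≤ ρ * √(∑ x, ∑ y, (G x y : ℝ) * (f x - f y) ^ 2)) :
    ∃ v, IsUnitVoltage G a b v := by
  let L : (V → ℝ) →ₗ[ℝ] V → ℝ :=
    { toFun := fun v x => ∑ y, (G x y : ℝ) * (v x - v y)
      map_add' := fun u v => by
        ext x
        simp only [Pi.add_apply, ← Finset.sum_add_distrib]
        exact Finset.sum_congr rfl fun y _ => by ring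
      map_smul' := fun c v => by
        ext x
        simp only [Pi.smul_apply, smul_eq_mul, RingHom.id_apply, Finset.mul_sum]
        exact Finset.sum_congr rfl fun y _ => by ring }
  set δ : V → ℝ := fun x => (if x = a then 1 else 0) - (if x = b then 1 else 0) with hδ
  by_contra! hno
  have hmem : δ ∉ LinearMap.range L := by
    rintro ⟨v, hv⟩
    exact hno v fun x => congrFun hv x
  obtain ⟨φ, hφ, hφL⟩ := Submodule.exists_le_ker_of_notMem hmem
  set g : V → ℝ := fun x => φ (Pi.single x 1) with hg
  have hrep : ∀ w : V → ℝ, φ w = ∑ x, g x * w x := fun w => by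
    conv_lhs => rw [LinearMap.pi_apply_eq_sum_univ φ w]
    refine Finset.sum_congr rfl fun x _ => ?_
    rw [smul_eq_mul, mul_comm, hg]
    congr 2
    ext y
    simp [Pi.single_apply, eq_comm]
  have h0 : φ (L g) = 0 := hφL ⟨g, rfl⟩
  rw [hrep] at h0
  have h1 := sum_mul_laplacian hG g g
  change ∑ x, g x * L g x = _ at h1
  rw [h0] at h1
  have h2 : ∑ x, ∑ y, (G x y : ℝ) * (g x - g y) ^ 2 = 0 := by
    simp_rw [pow_two]
    linarith
  have h3 := h g
  rw [h2, Real.sqrt_zero, mul_zero, abs_nonpos_iff] at h3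
  apply hφ
  rw [hrep]
  simp_rw [hδ, mul_sub, Finset.sum_sub_distrib]
  simpa using h3

/-- The sum over ordered pairs counts the energy of a voltage v twice, so it equals 2(v(a) - v(b));
inserting f = v and cancelling one factor gives 2ρ². -/
theorem effResistance_le (hG : ∀ x y, G x y = G y x) {a b : V} {ρ : ℝ}
    (h : ∀ f : V → ℝ, |f a - f b| ≤ ρ * √(∑ x, ∑ y, (G x y : ℝ) * (f x - f y) ^ 2)) :
    effResistance G a b ≤ ENNReal.ofReal (2 * ρ ^ 2) := by
  obtain ⟨v, hv⟩ := exists_isUnitVoltage hG h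
  refine (iInf₂_le v hv).trans (ENNReal.ofReal_le_ofReal ?_)
  have h1 := hv.sum_mul_sub_eq hG v
  have hE : 0 ≤ ∑ x, ∑ y, (G x y : ℝ) * (v x - v y) ^ 2 :=
    Finset.sum_nonneg fun _ _ => Finset.sum_nonneg fun _ _ => by positivity
  have h2 := h v
  simp_rw [← pow_two] at h1
  set E := ∑ x, ∑ y, (G x y : ℝ) * (v x - v y) ^ 2
  have h3 : (v a - v b) ^ 2 ≤ ρ ^ 2 * E := by
    calc (v a - v b) ^ 2 = |v a - v b| ^ 2 := (sq_abs _).symm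
      _ ≤ (ρ * √E) ^ 2 := by gcongr
      _ = ρ ^ 2 * E := by rw [mul_pow, Real.sq_sqrt hE]
  by_contra! hlt
  have hpos : 0 < v a - v b := lt_of_le_of_lt (by positivity) hlt
  nlinarith

/-- Dirichlet's principle: Cauchy–Schwarz between f and an arbitrary unit voltage. -/
theorem le_effResistance (hG : ∀ x y, G x y = G y x) {a b : V} {E : ℝ} (f : V → ℝ) (hE : 0 < E)
    (hf : ∑ x, ∑ y, (G x y : ℝ) * (f x - f y) ^ 2 ≤ E) :
    ENNReal.ofReal (2 * (f a - f b) ^ 2 / E) ≤ effResistance G a b := by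
  refine le_iInf₂ fun v hv => ENNReal.ofReal_le_ofReal ?_
  have h1 := hv.sum_mul_sub_eq hG v
  have h2 := hv.sum_mul_sub_eq hG f
  have h3 : (∑ x, ∑ y, (G x y : ℝ) * ((f x - f y) * (v x - v y))) ^ 2
      ≤ (∑ x, ∑ y, (G x y : ℝ) * (f x - f y) ^ 2) * ∑ x, ∑ y, (G x y : ℝ) * (v x - v y) ^ 2 := by
    have := Finset.sum_mul_sq_le_sq_mul_sq (Finset.univ : Finset (V × V))
      (fun p => √(G p.1 p.2 : ℝ) * (f p.1 - f p.2)) (fun p => √(G p.1 p.2 : ℝ) * (v p.1 - v p.2))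
    simp_rw [Fintype.sum_prod_type, mul_pow, Real.sq_sqrt (Nat.cast_nonneg _)] at this
    refine le_trans (le_of_eq ?_) this
    congr 1
    refine Finset.sum_congr rfl fun x _ => Finset.sum_congr rfl fun y _ => ?_
    have : (G x y : ℝ) = √(G x y : ℝ) * √(G x y : ℝ) :=
      (Real.mul_self_sqrt (Nat.cast_nonneg _)).symm
    conv_lhs => rw [this]
    ring
  simp_rw [← pow_two] at h1
  set Ev := ∑ x, ∑ y, (G x y : ℝ) * (v x - v y) ^ 2
  have hEv : 0 ≤ Ev :=
    Finset.sum_nonneg fun _ _ => Finset.sum_nonneg fun _ _ => by positivity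
  rw [div_le_iff₀ hE]
  set X := ∑ x, ∑ y, (G x y : ℝ) * ((f x - f y) * (v x - v y))
  rw [← h2, ← h1]
  nlinarith [mul_le_mul_of_nonneg_right hf hEv]

end network

theorem maxResistance_le_of_resBound {d q n : ℕ} {ρ : ℝ} (h0 : 0 ≤ ρ)
    (h : ResBound q (d + 2) n ρ) :
    maxResistance d (q + 1) n ≤ ENNReal.ofReal (2 * ρ ^ 2) := by
  refine iSup₂_le fun a b => effResistance_le (motherGraph_symm d (q + 1) n) fun f => ?_
  classical
  -- Extension by zero; only the values on words of length n enter.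
  set F : List (Fin (q + 1)) → ℝ := fun w => if hw : w.length = n then f ⟨w, hw⟩ else 0 with hF
  have hFf : ∀ x : List.Vector (Fin (q + 1)) n, F x.1 = f x := fun x => by
    rw [hF]
    exact dif_pos x.2
  have h1 := h F a.1 b.1 a.2 b.2
  have h2 := energy_le_motherGraph d q n F
  simp_rw [hFf] at h1 h2
  exact h1.trans (mul_le_mul_of_nonneg_left (Real.sqrt_le_sqrt h2) h0)


/-! ### The lower bound in degree zero -/

/-- One step of the recursion that defines the potential. -/
noncomputable def potStep (t : ℝ) (c : Fin (q + 1)) : ℝ :=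
  if c.val = 0 then q / (q + 1) * t else 1 - 1 / (q + 1) * t

/-- The potential of a word, started from the value `t`. For `t = 0` it is harmonic for the network
of degree zero, with value `0` at `0ⁿ` and `1` at the words `0ⁿ⁻¹ a` with `a ≠ 0`. -/
noncomputable def pot (t : ℝ) (u : List (Fin (q + 1))) : ℝ := u.foldl potStep t

/-- Each step is affine in t, with slope q/(q + 1) for the letter 0 and -1/(q + 1) otherwise; the
slope of a word is the product. -/
theorem pot_affine (t : ℝ) (u : List (Fin (q + 1))) :
    pot t u = pot 0 u + t * (pot 1 u - pot 0 u) := by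
  induction u generalizing t with
  | nil => simp [pot]
  | cons c u ih =>
    have h : ∀ t, pot t (c :: u) = pot (potStep t c) u := fun _ => rfl
    rw [h, h, h, ih (potStep t c), ih (potStep 0 c), ih (potStep 1 c)]
    unfold potStep
    split_ifs <;> ring

theorem potStep_one (c : Fin (q + 1)) : potStep 1 c = q / (q + 1) := by
  have : (q + 1 : ℝ) ≠ 0 := by positivity
  unfold potStep
  split_ifs
  · ring
  · field_simp; ring

/-- Leading zeros keep the value 0, any nonzero letter sends it to 1, and any letter after that
sends it to q/(q + 1). Hence neither the nonzero letter nor its successor matters. -/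
theorem pot_lamMap (s : TwoLevel (q + 1)) (u : List (Fin (q + 1))) :
    pot 0 (lamMap s [] u) = pot 0 u := by
  induction u with
  | nil => rfl
  | cons x u ih =>
    by_cases hx : x.val = 0
    · simpa [lamMap, hx, pot, potStep] using ih
    · have h := s.top_ne_zero x hx
      cases u with
      | nil => simp [lamMap, hx, h, pot, potStep, headMap]
      | cons b u =>
        simp only [lamMap, hx, if_false, pot, headMap, List.foldl_cons]
        have e : ∀ y : Fin (q + 1), y.val ≠ 0 → potStep 0 y = 1 := fun y hy => by
          simp [potStep, hy]
        rw [e _ h, e _ hx, potStep_one, potStep_one]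

theorem pot_levelGroup_one {g : Equiv.Perm (List (Fin (q + 1)))} (hg : g ∈ levelGroup (q + 1) 1)
    (u : List (Fin (q + 1))) : pot 0 (g u) = pot 0 u := by
  induction hg using Subgroup.closure_induction generalizing u with
  | mem g hg =>
    obtain ⟨w, s, hw, -, rfl⟩ := hg
    obtain rfl := List.length_eq_zero_iff.1 hw
    exact pot_lamMap s u
  | one => rfl
  | mul g h _ _ hg hh => rw [Equiv.Perm.mul_apply, hg, hh]
  | inv g _ hg =>
    obtain ⟨v, rfl⟩ := g.surjective u
    change pot 0 (g.symm (g v)) = _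
    rw [Equiv.symm_apply_apply, hg]

/-- Slopes multiply, and the squared slopes of the q + 1 letters add up to (q² + q)/(q + 1)² = q/(q
+ 1). -/
theorem sum_pot_sq (k : ℕ) (hq : 1 ≤ q) :
    ∑ u : List.Vector (Fin (q + 1)) k, (pot 1 u.1 - pot 0 u.1) ^ 2 = ((q : ℝ) / (q + 1)) ^ k := by
  induction k with
  | zero => rw [sum_vector_zero (fun u => (pot 1 u - pot 0 u) ^ 2)]; simp [pot]
  | succ k ih =>
    rw [sum_vector_cons k (fun u => (pot 1 u - pot 0 u) ^ 2)]
    have h : ∀ (c : Fin (q + 1)) (u : List (Fin (q + 1))), (pot 1 (c :: u) - pot 0 (c :: u)) ^ 2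
        = (potStep 1 c - potStep 0 c) ^ 2 * (pot 1 u - pot 0 u) ^ 2 := fun c u => by
      have h : ∀ t, pot t (c :: u) = pot (potStep t c) u := fun _ => rfl
      rw [h, h, pot_affine (potStep 1 c), pot_affine (potStep 0 c)]
      ring
    simp_rw [h, ← Finset.mul_sum, ih, ← Finset.sum_mul]
    rw [pow_succ, mul_comm]
    congr 1
    rw [Fin.sum_univ_succ]
    simp only [potStep, Fin.val_zero, Fin.val_succ, if_true, Nat.succ_ne_zero, if_false,
      Finset.sum_const, Finset.card_univ, Fintype.card_fin, nsmul_eq_mul]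
    field_simp
    ring

/-- Only edges that change the first letter carry energy; there the difference is at most the slope
of the common tail. -/
theorem motherGraph_mul_pot_le (k : ℕ) (x y : List.Vector (Fin (q + 1)) (k + 1)) :
    (motherGraph 0 (q + 1) (k + 1) x y : ℝ) * (pot 0 x.1 - pot 0 y.1) ^ 2
      ≤ Nat.card (levelGroup (q + 1) 0)
        * if x.1.tail = y.1.tail then (pot 1 x.1.tail - pot 0 x.1.tail) ^ 2 else 0 := by
  rw [motherGraph, Finset.sum_range_succ, Finset.sum_range_one, Nat.cast_add, add_mul]
  have h1 : (Nat.card {g : levelGroup (q + 1) 1 // g.1 x.1 = y.1} : ℝ)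
      * (pot 0 x.1 - pot 0 y.1) ^ 2 = 0 := by
    rcases isEmpty_or_nonempty {g : levelGroup (q + 1) 1 // g.1 x.1 = y.1} with he | ⟨⟨g, hg⟩⟩
    · simp
    · rw [← hg, pot_levelGroup_one g.2]; simp
  rw [h1, add_zero]
  rcases isEmpty_or_nonempty {g : levelGroup (q + 1) 0 // g.1 x.1 = y.1} with he | ⟨⟨g, hg⟩⟩
  · rw [Nat.card_of_isEmpty, Nat.cast_zero, zero_mul]
    split_ifs <;> positivity
  · obtain ⟨σ, hσ⟩ := exists_eq_headPerm g.2
    have hc : (Nat.card {g : levelGroup (q + 1) 0 // g.1 x.1 = y.1} : ℝ)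
        ≤ Nat.card (levelGroup (q + 1) 0) := by
      exact_mod_cast Nat.card_le_card_of_injective _ Subtype.val_injective
    have hxl := x.2
    generalize x.1 = x' at *
    generalize y.1 = y' at *
    rcases x' with _ | ⟨a, u⟩
    · simp at hxl
    · rw [hσ] at hg
      have hy : y' = σ a :: u := hg.symm
      subst hy
      rw [List.tail_cons, List.tail_cons, if_pos rfl]
      refine mul_le_mul hc ?_ (sq_nonneg _) (Nat.cast_nonneg _)
      have h : ∀ c, pot 0 (c :: u) = pot (potStep 0 c) u := fun _ => rfl
      rw [h, h, pot_affine (potStep 0 a), pot_affine (potStep 0 (σ a))]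
      have h2 : (potStep 0 a - potStep 0 (σ a)) ^ 2 ≤ (1 : ℝ) := by
        unfold potStep
        split_ifs <;> norm_num
      calc _ = (potStep 0 a - potStep 0 (σ a)) ^ 2 * (pot 1 u - pot 0 u) ^ 2 := by ring
        _ ≤ 1 * (pot 1 u - pot 0 u) ^ 2 := by gcongr
        _ = _ := one_mul _

theorem sum_motherGraph_mul_pot_le (k : ℕ) (hq : 1 ≤ q) :
    ∑ x, ∑ y, (motherGraph 0 (q + 1) (k + 1) x y : ℝ) * (pot 0 x.1 - pot 0 y.1) ^ 2
      ≤ Nat.card (levelGroup (q + 1) 0) * ((q + 1 : ℝ) ^ 2 * ((q : ℝ) / (q + 1)) ^ k) := by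
  refine (Finset.sum_le_sum fun x _ => Finset.sum_le_sum fun y _ =>
    motherGraph_mul_pot_le k x y).trans (le_of_eq ?_)
  simp_rw [← Finset.mul_sum]
  congr 1
  rw [sum_vector_cons k (fun x => ∑ y : List.Vector (Fin (q + 1)) (k + 1),
    if x.tail = y.1.tail then (pot 1 x.tail - pot 0 x.tail) ^ 2 else 0)]
  have h : ∀ (a : Fin (q + 1)) (u : List.Vector (Fin (q + 1)) k),
      ∑ y : List.Vector (Fin (q + 1)) (k + 1), (if (a :: u.1).tail = y.1.tail then
        (pot 1 (a :: u.1).tail - pot 0 (a :: u.1).tail) ^ 2 else 0)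
      = (q + 1) * (pot 1 u.1 - pot 0 u.1) ^ 2 := fun a u => by
    rw [sum_vector_cons k (fun y => if (a :: u.1).tail = y.tail then
      (pot 1 (a :: u.1).tail - pot 0 (a :: u.1).tail) ^ 2 else 0)]
    simp only [List.tail_cons]
    have h : ∀ v : List.Vector (Fin (q + 1)) k, (u.1 = v.1) = (u = v) := fun v =>
      propext ⟨fun h => Subtype.ext h, fun h => congrArg _ h⟩
    simp_rw [h]
    simp
  simp_rw [h, ← Finset.mul_sum, sum_pot_sq k hq]
  simp
  ring

theorem exists_le_maxResistance (hq : 1 ≤ q) : ∃ c : ℝ, 0 < c ∧ ∀ n : ℕ, 1 ≤ n →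
    ENNReal.ofReal (c * ((q + 1 : ℝ) / q) ^ n) ≤ maxResistance 0 (q + 1) n := by
  have hq0 : (0 : ℝ) < q := by exact_mod_cast hq
  have hN : (0 : ℝ) < Nat.card (levelGroup (q + 1) 0) := by exact_mod_cast Nat.card_pos
  refine ⟨2 / (Nat.card (levelGroup (q + 1) 0) * (q + 1 : ℝ) ^ 2) * (q / (q + 1)), by positivity,
    fun n hn => ?_⟩
  obtain ⟨k, rfl⟩ : ∃ k, n = k + 1 := ⟨n - 1, by omega⟩
  have hz : pot 0 (List.replicate k 0 : List (Fin (q + 1))) = 0 := by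
    induction k with
    | zero => rfl
    | succ k ih => simpa [List.replicate_succ, pot, potStep] using ih (by omega)
  set a : List.Vector (Fin (q + 1)) (k + 1) := ⟨List.replicate k 0 ++ [0], by simp⟩ with ha
  set b : List.Vector (Fin (q + 1)) (k + 1) := ⟨List.replicate k 0 ++ [Fin.succ ⟨0, hq⟩], by simp⟩
    with hb
  refine le_trans ?_ (le_iSup₂ (f := fun x y => effResistance (motherGraph 0 (q + 1) (k + 1)) x y)
    a b)
  refine le_trans (ENNReal.ofReal_le_ofReal (le_of_eq ?_))
    (le_effResistance (motherGraph_symm 0 (q + 1) (k + 1)) (fun x => pot 0 x.1) (by positivity)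
      (sum_motherGraph_mul_pot_le k hq))
  have h1 : pot 0 a.1 = 0 := by
    change pot 0 (List.replicate k 0 ++ [0]) = 0
    unfold pot at hz ⊢
    rw [List.foldl_append, hz]
    simp [potStep]
  have h2 : pot 0 b.1 = 1 := by
    change pot 0 (List.replicate k 0 ++ [Fin.succ ⟨0, hq⟩]) = 1
    unfold pot at hz ⊢
    rw [List.foldl_append, hz]
    simp [potStep]
  rw [h1, h2, pow_succ, div_pow, div_pow]
  field_simp
  ring

/-! ### The upper bounds -/

theorem exists_maxResistance_zero_le (hq : 1 ≤ q) : ∃ c : ℝ, 0 < c ∧ ∀ n : ℕ,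
    maxResistance 0 (q + 1) n ≤ ENNReal.ofReal (c * ((q + 1 : ℝ) / q) ^ n) := by
  obtain ⟨A, hA, h⟩ := exists_resBound_two hq
  have hq0 : (0 : ℝ) < q := by exact_mod_cast hq
  refine ⟨2 * A ^ 2, by positivity, fun n => ?_⟩
  refine (maxResistance_le_of_resBound (d := 0) (by positivity) (h n)).trans
    (ENNReal.ofReal_le_ofReal (le_of_eq ?_))
  have e : growth q = (q + 1 : ℝ) / q := by unfold growth; field_simp
  have h0 : 0 ≤ growth q := by linarith [one_lt_growth hq]
  rw [← e, mul_pow, ← pow_mul, mul_comm n 2, pow_mul, Real.sq_sqrt h0]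
  ring

theorem maxResistance_le_rpow {d n : ℕ} {A α : ℝ} (hA : 0 ≤ A)
    (h : ResBound q (d + 2) n (A * (n : ℝ) ^ (α / 2))) :
    maxResistance d (q + 1) n ≤ ENNReal.ofReal (2 * A ^ 2 * (n : ℝ) ^ α) := by
  refine (maxResistance_le_of_resBound (by positivity) h).trans
    (ENNReal.ofReal_le_ofReal (le_of_eq ?_))
  rw [mul_pow, ← Real.rpow_mul_natCast (by positivity), Nat.cast_ofNat,
    div_mul_cancel₀ _ (two_ne_zero' ℝ)]
  ring

theorem exists_resBound_four (hq : 1 ≤ q) :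
    ∃ A : ℝ, 0 < A ∧ ∀ n : ℕ, 1 ≤ n →
      ResBound q 4 n (A * (n : ℝ) ^ ((1 - Real.logb (q + 1 : ℝ) q) / 2)) := by
  obtain ⟨A, hA, h⟩ := exists_resBound_three hq
  have hL := (logb_nonneg_and_lt_one hq).2
  have := exists_resBound_succ_of_half_lt hq (by linarith) hA.le h
  convert this using 8
  ring

theorem exists_resBound_five_of_two_le (hq : 2 ≤ q) :
    ∃ A : ℝ, 0 < A ∧ ∀ n : ℕ, 1 ≤ n → ResBound q 5 n A := by
  obtain ⟨A, hA, h⟩ := exists_resBound_four (q := q) (by omega)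
  have hL := (logb_nonneg_and_lt_one (q := q) (by omega)).2
  have hq' : (2 : ℝ) ≤ q := by exact_mod_cast hq
  have hL0 : 0 < Real.logb (q + 1 : ℝ) q := Real.logb_pos (by linarith) (by linarith)
  exact exists_resBound_succ_of_lt_half (by omega) (by linarith) (by linarith) hA.le h

theorem exists_resBound_one_four : ∃ A : ℝ, 0 < A ∧ ∀ n : ℕ, 1 ≤ n →
    ResBound 1 4 n (A * (n : ℝ) ^ (1 / 2 : ℝ)) := by
  have := exists_resBound_four (q := 1) le_rfl
  simpa using this

theorem exists_resBound_one_five : ∃ A : ℝ, 0 < A ∧ ∀ n : ℕ, 2 ≤ n →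
    ResBound 1 5 n (A * Real.log n) := by
  obtain ⟨A, hA, h⟩ := exists_resBound_one_four
  exact exists_resBound_succ_of_eq_half le_rfl hA.le h

theorem exists_resBound_one_six : ∃ A : ℝ, 0 < A ∧ ∀ n : ℕ, 1 ≤ n → ResBound 1 6 n A := by
  obtain ⟨A, hA, h4⟩ := exists_resBound_one_four
  obtain ⟨B, hB, h5⟩ := exists_resBound_one_five
  -- The logarithm is absorbed into a power; any exponent in (0, 1/2) would do.
  refine exists_resBound_succ_of_lt_half (K := 5) (α := 1 / 4) (C := A + B * 4) le_rfl
    (by norm_num) (by norm_num) (by positivity) fun n hn => ?_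
  have hn1 : (1 : ℝ) ≤ n := by exact_mod_cast hn
  rcases hn.eq_or_lt with rfl | hn2
  · refine (h4 1 le_rfl).mono (by norm_num) ?_ (by positivity)
    simp only [Nat.cast_one, Real.one_rpow, mul_one]
    linarith
  · refine (h5 n hn2).mono le_rfl ?_ (by positivity)
    have h1 : Real.log n ≤ (n : ℝ) ^ (1 / 4 : ℝ) / (1 / 4) :=
      Real.log_le_rpow_div (by positivity) (by norm_num)
    have h2 : 0 ≤ (n : ℝ) ^ (1 / 4 : ℝ) := by positivity
    calc B * Real.log n ≤ B * ((n : ℝ) ^ (1 / 4 : ℝ) / (1 / 4)) := by gcongr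
      _ = B * 4 * (n : ℝ) ^ (1 / 4 : ℝ) := by ring
      _ ≤ _ := by gcongr; linarith

theorem exists_resBound_of_transient {d : ℕ} (hq : 1 ≤ q) (h : 4 ≤ d ∨ (3 ≤ d ∧ 2 ≤ q)) :
    ∃ A : ℝ, 0 < A ∧ ∀ n : ℕ, 1 ≤ n → ResBound q (d + 2) n A := by
  by_cases hq2 : 2 ≤ q
  · obtain ⟨A, hA, H⟩ := exists_resBound_five_of_two_le hq2
    exact ⟨A, hA, fun n hn => (H n hn).mono (by omega) le_rfl hA.le⟩
  · obtain rfl : q = 1 := by omega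
    obtain ⟨A, hA, H⟩ := exists_resBound_one_six
    exact ⟨A, hA, fun n hn => (H n hn).mono (by omega) le_rfl hA.le⟩

end FractalMother

theorem mainTheorem3 (d m : ℕ) (hm : 2 ≤ m) :
    (∃ c : ℝ, 0 < c ∧
      (d = 0 → ∀ n : ℕ, 1 ≤ n →
        FractalMother.maxResistance d m n
          ≤ ENNReal.ofReal (c * ((m : ℝ) / ((m : ℝ) - 1)) ^ n)) ∧
      (d = 1 ∨ d = 2 → ∀ n : ℕ, 1 ≤ n →
        FractalMother.maxResistance d m n
          ≤ ENNReal.ofReal (c * (n : ℝ) ^ (3 - (d : ℝ) - Real.logb (m : ℝ) ((m : ℝ) - 1)))) ∧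
      (d = 3 ∧ m = 2 → ∀ n : ℕ, 2 ≤ n →
        FractalMother.maxResistance d m n ≤ ENNReal.ofReal (c * Real.log (n : ℝ) ^ 2)) ∧
      (4 ≤ d ∨ (3 ≤ d ∧ 3 ≤ m) → ∀ n : ℕ, 1 ≤ n →
        FractalMother.maxResistance d m n ≤ ENNReal.ofReal c)) ∧
    (d = 0 → ∃ c : ℝ, 0 < c ∧ ∀ n : ℕ, 1 ≤ n →
      ENNReal.ofReal (c * ((m : ℝ) / ((m : ℝ) - 1)) ^ n)
        ≤ FractalMother.maxResistance d m n) := by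
  obtain ⟨q, rfl⟩ : ∃ q, m = q + 1 := ⟨m - 1, by omega⟩
  have hq : 1 ≤ q := by omega
  have e : ((q + 1 : ℕ) : ℝ) - 1 = q := by push_cast; ring
  rw [e, Nat.cast_add, Nat.cast_one]
  refine ⟨?_, fun hd => hd ▸ FractalMother.exists_le_maxResistance hq⟩
  -- The constant may depend on d, so in each case it comes from the single clause that is not
  -- vacuous.
  rcases Nat.lt_or_ge d 1 with h0 | h1
  · obtain rfl : d = 0 := by omega
    obtain ⟨c, hc, h⟩ := FractalMother.exists_maxResistance_zero_le hq
    exact ⟨c, hc, fun _ n _ => h n, by omega, by omega, by omega⟩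
  rcases Nat.lt_or_ge d 2 with h2 | h2
  · obtain rfl : d = 1 := by omega
    obtain ⟨A, hA, h⟩ := FractalMother.exists_resBound_three hq
    refine ⟨2 * A ^ 2, by positivity, by omega, fun _ n hn => ?_, by omega, by omega⟩
    rw [show (3 : ℝ) - ((1 : ℕ) : ℝ) - Real.logb (q + 1) q = 2 - Real.logb (q + 1) q by
      push_cast; ring]
    exact FractalMother.maxResistance_le_rpow hA.le (h n hn)
  rcases Nat.lt_or_ge d 3 with h3 | h3
  · obtain rfl : d = 2 := by omega
    obtain ⟨A, hA, h⟩ := FractalMother.exists_resBound_four hq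
    refine ⟨2 * A ^ 2, by positivity, by omega, fun _ n hn => ?_, by omega, by omega⟩
    rw [show (3 : ℝ) - ((2 : ℕ) : ℝ) - Real.logb (q + 1) q = 1 - Real.logb (q + 1) q by
      push_cast; ring]
    exact FractalMother.maxResistance_le_rpow hA.le (h n hn)
  by_cases ht : 4 ≤ d ∨ (3 ≤ d ∧ 2 ≤ q)
  · obtain ⟨A, hA, h⟩ := FractalMother.exists_resBound_of_transient hq ht
    exact ⟨2 * A ^ 2, by positivity, by omega, by omega, by omega, fun _ n hn =>
      FractalMother.maxResistance_le_of_resBound hA.le (h n hn)⟩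
  · obtain rfl : d = 3 := by omega
    obtain rfl : q = 1 := by omega
    obtain ⟨A, hA, h⟩ := FractalMother.exists_resBound_one_five
    refine ⟨2 * A ^ 2, by positivity, by omega, by omega, fun _ n hn => ?_, by omega⟩
    have hl : 0 ≤ Real.log n := Real.log_natCast_nonneg n
    refine (FractalMother.maxResistance_le_of_resBound (by positivity) (h n hn)).trans
      (ENNReal.ofReal_le_ofReal (le_of_eq ?_))
    ring
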